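/- Let $X$ be a separable real Banach space. A type on $X$ is a function $\sigma:X\to[0,\infty)$ for which there is a sequence $(x_n)$ in $X$ with $\sigma(y)=\lim_{n}\|y+x_n\|$ for all $y\in X$; we then say that $(x_n)$ determines $\sigma$. Suppose that $X$ is stable, i.e. whenever $(x_n)$ and $(y_m)$ in $X$ determine types, $\lim_n\lim_m\|x_n+y_m\|=\lim_m\lim_n\|x_n+y_m\|$. Let $\mathcal M(X)$ be the space of (signed) Radon measures on $X$ with the total variation norm, let $C_b(X)$ be the space of bounded continuous real functions on $X$ with the uniform norm, and let $\Phi:\mathcal M(X)\to C_b(X)$, $\Phi(\mu)(y)=\int_X e^{-\|x-y\|}\,\mu(dx)$. Let $A_0=\Phi(\mathcal M(X))$, normed by the gauge of the image under $\Phi$ of the unit ball of $\mathcal M(X)$, and let $A_1=C_b(X)$. For $0<\theta<1$ and $1<p<\infty$ let $R=[A_0,A_1]_{\theta,p}$ be the Lions–Peetre interpolation space: the space of all $z\in A_1$ that admit a representation $z=x_1(t)+x_2(t)$, $t\in\mathbb R$, with $e^{\theta t}x_1(t)\in L_p(\mathbb R;A_0)$ and $e^{-(1-\theta)t}x_2(t)\in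 L_p(\mathbb R;A_1)$, with the norm $$\|z\|_R=\inf\ \|e^{\theta t}x_1(t)\|_{L_p(A_0)}^{1-\theta}\,\|e^{-(1-\theta)t}x_2(t)\|_{L_p(A_1)}^{\theta},$$ the infimum being over all such representations. For $z\in X$ let $T_z$ be the translation operator on $R$, $(T_zf)(x)=f(x-z)$. Then there is a unique map $\sigma\mapsto T_\sigma$ from the set of types on $X$ to the bounded operators on $R$ such that, whenever a sequence $(x_n)$ determines $\sigma$, $T_{x_n}\to T_\sigma$ in the weak operator topology. For every sequence $(\sigma_n)$ of types on $X$ and every type $\sigma$ on $X$, the following are equivalent: (a) $\sigma_n\to\sigma$ in the topology $s$, i.e. uniformly on every bounded subset of $X$; (b) $T_{\sigma_n}\to T_\sigma$ in the strong operator topology, i.e. $\|T_{\sigma_n}r-T_\sigma r\|_R\to 0$ for every $r\in R$. -/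

import Mathlib

open Filter Topology MeasureTheory Set
open scoped ENNReal NNReal BoundedContinuousFunction

set_option linter.unusedSectionVars false

noncomputable section

namespace StableRep

/-! ### Lions-Peetre interpolation of a pair `A₀ → A₁`

The pair consists of two real normed spaces and a continuous linear map `j` (the embedding) from
`A₀` into `A₁`; the sum `A₀ + A₁` is `A₁`. -/

section Interpolation

variable {A₀ A₁ : Type*} [NormedAddCommGroup A₀] [NormedSpace ℝ A₀]
  [NormedAddCommGroup A₁] [NormedSpace ℝ A₁]

/-- A representation `z = x₁(t) + x₂(t)`, `t ∈ ℝ`, with `e^{θt} x₁(t) ∈ L_p(A₀)` and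
`e^{-(1-θ)t} x₂(t) ∈ L_p(A₁)`. -/
structure Decomp (j : A₀ →L[ℝ] A₁) (θ : ℝ) (p : ℝ≥0∞) (z : A₁) where
  x₁ : ℝ → A₀
  x₂ : ℝ → A₁
  memLp₁ : MemLp (fun t : ℝ => Real.exp (θ * t) • x₁ t) p volume
  memLp₂ : MemLp (fun t : ℝ => Real.exp (-(1 - θ) * t) • x₂ t) p volume
  add_eq : ∀ t, j (x₁ t) + x₂ t = z

namespace Decomp

variable {j : A₀ →L[ℝ] A₁} {θ : ℝ} {p : ℝ≥0∞} {z w : A₁}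

/-- The norm of `e^{θt} x₁(t)` in `L_p(A₀)`. -/
def N₁ (D : Decomp j θ p z) : ℝ :=
  (eLpNorm (fun t : ℝ => Real.exp (θ * t) • D.x₁ t) p volume).toReal

/-- The norm of `e^{-(1-θ)t} x₂(t)` in `L_p(A₁)`. -/
def N₂ (D : Decomp j θ p z) : ℝ :=
  (eLpNorm (fun t : ℝ => Real.exp (-(1 - θ) * t) • D.x₂ t) p volume).toReal

/-- `‖e^{θt} x₁(t)‖_p^{1-θ} ‖e^{-(1-θ)t} x₂(t)‖_p^θ`. -/
def value (D : Decomp j θ p z) : ℝ := D.N₁ ^ (1 - θ) * D.N₂ ^ θ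

lemma N₁_nonneg (D : Decomp j θ p z) : 0 ≤ D.N₁ := ENNReal.toReal_nonneg
lemma N₂_nonneg (D : Decomp j θ p z) : 0 ≤ D.N₂ := ENNReal.toReal_nonneg
lemma value_nonneg (D : Decomp j θ p z) : 0 ≤ D.value :=
  mul_nonneg (Real.rpow_nonneg D.N₁_nonneg _) (Real.rpow_nonneg D.N₂_nonneg _)

/-- The trivial representation of `0`. -/
def zero (j : A₀ →L[ℝ] A₁) (θ : ℝ) (p : ℝ≥0∞) : Decomp j θ p 0 where
  x₁ := fun _ => 0
  x₂ := fun _ => 0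
  memLp₁ := by simp
  memLp₂ := by simp
  add_eq := by simp

/-- Sum of two representations. -/
def add (D : Decomp j θ p z) (E : Decomp j θ p w) : Decomp j θ p (z + w) where
  x₁ := fun t => D.x₁ t + E.x₁ t
  x₂ := fun t => D.x₂ t + E.x₂ t
  memLp₁ := (funext fun t => by simp [smul_add] :
    (fun t : ℝ => Real.exp (θ * t) • D.x₁ t) + (fun t : ℝ => Real.exp (θ * t) • E.x₁ t)
      = fun t : ℝ => Real.exp (θ * t) • (D.x₁ t + E.x₁ t)) ▸ D.memLp₁.add E.memLp₁
  memLp₂ := (funext fun t => by simp [smul_add] :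
    (fun t : ℝ => Real.exp (-(1 - θ) * t) • D.x₂ t)
      + (fun t : ℝ => Real.exp (-(1 - θ) * t) • E.x₂ t)
      = fun t : ℝ => Real.exp (-(1 - θ) * t) • (D.x₂ t + E.x₂ t)) ▸ D.memLp₂.add E.memLp₂
  add_eq := fun t => by
    have h₁ := D.add_eq t
    have h₂ := E.add_eq t
    rw [map_add, add_add_add_comm, h₁, h₂]

/-- Scalar multiple of a representation. -/
def smul (c : ℝ) (D : Decomp j θ p z) : Decomp j θ p (c • z) where
  x₁ := fun t => c • D.x₁ t
  x₂ := fun t => c • D.x₂ t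
  memLp₁ := (funext fun t => by simp [smul_comm c] :
    c • (fun t : ℝ => Real.exp (θ * t) • D.x₁ t)
      = fun t : ℝ => Real.exp (θ * t) • c • D.x₁ t) ▸ D.memLp₁.const_smul c
  memLp₂ := (funext fun t => by simp [smul_comm c] :
    c • (fun t : ℝ => Real.exp (-(1 - θ) * t) • D.x₂ t)
      = fun t : ℝ => Real.exp (-(1 - θ) * t) • c • D.x₂ t) ▸ D.memLp₂.const_smul c
  add_eq := fun t => by
    have h := D.add_eq t
    rw [map_smul, ← smul_add, h]

lemma N₁_smul (c : ℝ) (D : Decomp j θ p z) : (D.smul c).N₁ = |c| * D.N₁ := by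
  have : (fun t : ℝ => Real.exp (θ * t) • (D.smul c).x₁ t)
      = c • (fun t : ℝ => Real.exp (θ * t) • D.x₁ t) := by
    funext t; simp [smul, smul_comm c]
  rw [N₁, this, eLpNorm_const_smul, ENNReal.toReal_mul, N₁]; simp

lemma N₂_smul (c : ℝ) (D : Decomp j θ p z) : (D.smul c).N₂ = |c| * D.N₂ := by
  have : (fun t : ℝ => Real.exp (-(1 - θ) * t) • (D.smul c).x₂ t)
      = c • (fun t : ℝ => Real.exp (-(1 - θ) * t) • D.x₂ t) := by
    funext t; simp [smul, smul_comm c]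
  rw [N₂, this, eLpNorm_const_smul, ENNReal.toReal_mul, N₂]; simp

lemma value_smul (c : ℝ) (D : Decomp j θ p z) : (D.smul c).value = |c| * D.value := by
  rw [value, N₁_smul, N₂_smul, Real.mul_rpow (abs_nonneg c) D.N₁_nonneg,
    Real.mul_rpow (abs_nonneg c) D.N₂_nonneg, value]
  have : |c| = |c| ^ (1 - θ) * |c| ^ θ := by
    rw [← Real.rpow_add' (abs_nonneg c) (by simp)]; simp
  calc _ = (|c| ^ (1 - θ) * |c| ^ θ) * (D.N₁ ^ (1 - θ) * D.N₂ ^ θ) := by ring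
    _ = _ := by rw [← this]

lemma N₁_add (hp : 1 ≤ p) (D : Decomp j θ p z) (E : Decomp j θ p w) :
    (D.add E).N₁ ≤ D.N₁ + E.N₁ := by
  have : (fun t : ℝ => Real.exp (θ * t) • (D.add E).x₁ t)
      = (fun t : ℝ => Real.exp (θ * t) • D.x₁ t) + (fun t : ℝ => Real.exp (θ * t) • E.x₁ t) := by
    funext t; simp [add]
  rw [N₁, this, N₁, N₁, ← ENNReal.toReal_add D.memLp₁.2.ne E.memLp₁.2.ne]
  exact ENNReal.toReal_mono (ENNReal.add_ne_top.2 ⟨D.memLp₁.2.ne, E.memLp₁.2.ne⟩)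
    (eLpNorm_add_le D.memLp₁.1 E.memLp₁.1 hp)

lemma N₂_add (hp : 1 ≤ p) (D : Decomp j θ p z) (E : Decomp j θ p w) :
    (D.add E).N₂ ≤ D.N₂ + E.N₂ := by
  have : (fun t : ℝ => Real.exp (-(1 - θ) * t) • (D.add E).x₂ t)
      = (fun t : ℝ => Real.exp (-(1 - θ) * t) • D.x₂ t)
        + (fun t : ℝ => Real.exp (-(1 - θ) * t) • E.x₂ t) := by
    funext t; simp [add]
  rw [N₂, this, N₂, N₂, ← ENNReal.toReal_add D.memLp₂.2.ne E.memLp₂.2.ne]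
  exact ENNReal.toReal_mono (ENNReal.add_ne_top.2 ⟨D.memLp₂.2.ne, E.memLp₂.2.ne⟩)
    (eLpNorm_add_le D.memLp₂.1 E.memLp₂.1 hp)

lemma shift_eq₁ (D : Decomp j θ p z) (s : ℝ) :
    (fun t : ℝ => Real.exp (θ * t) • D.x₁ (t + s))
      = Real.exp (-(θ * s)) • ((fun t : ℝ => Real.exp (θ * t) • D.x₁ t) ∘ fun t => t + s) := by
  funext t
  simp only [Pi.smul_apply, Function.comp, smul_smul, ← Real.exp_add]
  congr 2; ring

lemma shift_eq₂ (D : Decomp j θ p z) (s : ℝ) :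
    (fun t : ℝ => Real.exp (-(1 - θ) * t) • D.x₂ (t + s))
      = Real.exp ((1 - θ) * s) •
        ((fun t : ℝ => Real.exp (-(1 - θ) * t) • D.x₂ t) ∘ fun t => t + s) := by
  funext t
  simp only [Pi.smul_apply, Function.comp, smul_smul, ← Real.exp_add]
  congr 2; ring

/-- Translation of the parameter `t` in a representation. -/
def shift (D : Decomp j θ p z) (s : ℝ) : Decomp j θ p z where
  x₁ := fun t => D.x₁ (t + s)
  x₂ := fun t => D.x₂ (t + s)
  memLp₁ := by
    rw [shift_eq₁]
    exact (D.memLp₁.comp_measurePreserving (measurePreserving_add_right volume s)).const_smul _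
  memLp₂ := by
    rw [shift_eq₂]
    exact (D.memLp₂.comp_measurePreserving (measurePreserving_add_right volume s)).const_smul _
  add_eq := fun t => D.add_eq (t + s)

lemma N₁_shift (D : Decomp j θ p z) (s : ℝ) : (D.shift s).N₁ = Real.exp (-(θ * s)) * D.N₁ := by
  have : (fun t : ℝ => Real.exp (θ * t) • (D.shift s).x₁ t) = _ := shift_eq₁ D s
  rw [N₁, this, eLpNorm_const_smul,
    eLpNorm_comp_measurePreserving D.memLp₁.1 (measurePreserving_add_right volume s),
    ENNReal.toReal_mul, N₁]
  simp

lemma N₂_shift (D : Decomp j θ p z) (s : ℝ) :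
    (D.shift s).N₂ = Real.exp ((1 - θ) * s) * D.N₂ := by
  have : (fun t : ℝ => Real.exp (-(1 - θ) * t) • (D.shift s).x₂ t) = _ := shift_eq₂ D s
  rw [N₂, this, eLpNorm_const_smul,
    eLpNorm_comp_measurePreserving D.memLp₂.1 (measurePreserving_add_right volume s),
    ENNReal.toReal_mul, N₂]
  simp

lemma exists_balanced (D : Decomp j θ p z) {A B : ℝ} (hA : 0 < A) (hB : 0 < B)
    (h₁ : D.N₁ ≤ A) (h₂ : D.N₂ ≤ B) :
    ∃ E : Decomp j θ p z, E.N₁ ≤ A ^ (1 - θ) * B ^ θ ∧ E.N₂ ≤ A ^ (1 - θ) * B ^ θ := by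
  refine ⟨D.shift (Real.log A - Real.log B), ?_, ?_⟩
  · rw [N₁_shift]
    calc _ ≤ Real.exp (-(θ * (Real.log A - Real.log B))) * A := by gcongr
      _ = Real.exp (-(θ * (Real.log A - Real.log B))) * Real.exp (Real.log A) := by
        rw [Real.exp_log hA]
      _ = _ := by
        rw [Real.rpow_def_of_pos hA, Real.rpow_def_of_pos hB, ← Real.exp_add, ← Real.exp_add]
        congr 1; ring
  · rw [N₂_shift]
    calc _ ≤ Real.exp ((1 - θ) * (Real.log A - Real.log B)) * B := by gcongr
      _ = Real.exp ((1 - θ) * (Real.log A - Real.log B)) * Real.exp (Real.log B) := by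
        rw [Real.exp_log hB]
      _ = _ := by
        rw [Real.rpow_def_of_pos hA, Real.rpow_def_of_pos hB, ← Real.exp_add, ← Real.exp_add]
        congr 1; ring

lemma exists_lt (h0 : 0 < θ) (h1 : θ < 1) (D : Decomp j θ p z) {c : ℝ} (h : D.value < c) :
    ∃ E : Decomp j θ p z, E.N₁ < c ∧ E.N₂ < c := by
  have hc : Tendsto (fun e : ℝ => (D.N₁ + e) ^ (1 - θ) * (D.N₂ + e) ^ θ) (𝓝[>] 0)
      (𝓝 D.value) := by
    have : ContinuousAt (fun e : ℝ => (D.N₁ + e) ^ (1 - θ) * (D.N₂ + e) ^ θ) 0 := by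
      apply ContinuousAt.mul
      · exact (continuousAt_const.add continuousAt_id).rpow_const (Or.inr (by linarith))
      · exact (continuousAt_const.add continuousAt_id).rpow_const (Or.inr h0.le)
    have h2 := this.tendsto
    simp only [add_zero] at h2
    exact h2.mono_left nhdsWithin_le_nhds
  obtain ⟨e, he, hpos⟩ := ((hc.eventually_lt_const h).and self_mem_nhdsWithin).exists
  have hpos : 0 < e := hpos
  obtain ⟨E, h₁, h₂⟩ := D.exists_balanced (A := D.N₁ + e) (B := D.N₂ + e)
    (by have := D.N₁_nonneg; linarith) (by have := D.N₂_nonneg; linarith)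
    (by linarith) (by linarith)
  exact ⟨E, h₁.trans_lt he, h₂.trans_lt he⟩

lemma value_le (h0 : 0 < θ) (h1 : θ < 1) (D : Decomp j θ p z) {c : ℝ} (h₁ : D.N₁ ≤ c)
    (h₂ : D.N₂ ≤ c) : D.value ≤ c := by
  have hc : 0 ≤ c := D.N₁_nonneg.trans h₁
  calc D.value ≤ c ^ (1 - θ) * c ^ θ :=
        mul_le_mul (Real.rpow_le_rpow D.N₁_nonneg h₁ (by linarith))
          (Real.rpow_le_rpow D.N₂_nonneg h₂ h0.le) (Real.rpow_nonneg D.N₂_nonneg _)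
          (Real.rpow_nonneg hc _)
    _ = c := by rw [← Real.rpow_add' hc (by simp)]; simp

lemma norm_le (h0 : 0 < θ) (h1 : θ < 1) (hp : 1 ≤ p) (hp' : p ≠ ⊤)
    (D : Decomp j θ p z) : ‖z‖ ≤ ‖j‖ * D.N₁ + Real.exp (1 - θ) * D.N₂ := by
  set I : Set ℝ := Icc 0 1
  set ν : Measure ℝ := volume.restrict I with hν
  have hm₁ : AEStronglyMeasurable D.x₁ volume := by
    have : D.x₁ = fun t => Real.exp (-(θ * t)) • (Real.exp (θ * t) • D.x₁ t) := by
      funext t; rw [smul_smul, ← Real.exp_add]; simp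
    rw [this]
    exact (by fun_prop : Continuous fun t : ℝ => Real.exp (-(θ * t))).aestronglyMeasurable.smul
      D.memLp₁.1
  have hm₂ : AEStronglyMeasurable D.x₂ volume := by
    have : D.x₂ = fun t => Real.exp ((1 - θ) * t) • (Real.exp (-(1 - θ) * t) • D.x₂ t) := by
      funext t; rw [smul_smul, ← Real.exp_add, neg_mul, add_neg_cancel]; simp
    rw [this]
    exact (by fun_prop : Continuous fun t : ℝ => Real.exp ((1 - θ) * t)).aestronglyMeasurable.smul
      D.memLp₂.1
  have hI : ∀ᵐ t ∂ν, t ∈ I := ae_restrict_mem measurableSet_Icc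
  have e₁ : eLpNorm (fun t => j (D.x₁ t)) p ν ≤ ENNReal.ofReal (‖j‖ * D.N₁) := by
    have : eLpNorm (fun t => j (D.x₁ t)) p ν ≤ ENNReal.ofReal ‖j‖ *
        eLpNorm (fun t : ℝ => Real.exp (θ * t) • D.x₁ t) p ν := by
      apply eLpNorm_le_mul_eLpNorm_of_ae_le_mul
      filter_upwards [hI] with t ht
      refine (j.le_opNorm _).trans ?_
      gcongr
      rw [norm_smul, Real.norm_eq_abs, Real.abs_exp]
      exact le_mul_of_one_le_left (norm_nonneg _) (Real.one_le_exp (mul_nonneg h0.le ht.1))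
    refine this.trans ?_
    rw [ENNReal.ofReal_mul (norm_nonneg _), N₁, ENNReal.ofReal_toReal D.memLp₁.2.ne]
    gcongr
    exact Measure.restrict_le_self
  have e₂ : eLpNorm D.x₂ p ν ≤ ENNReal.ofReal (Real.exp (1 - θ) * D.N₂) := by
    have : eLpNorm D.x₂ p ν ≤ ENNReal.ofReal (Real.exp (1 - θ)) *
        eLpNorm (fun t : ℝ => Real.exp (-(1 - θ) * t) • D.x₂ t) p ν := by
      apply eLpNorm_le_mul_eLpNorm_of_ae_le_mul
      filter_upwards [hI] with t ht
      rw [norm_smul, Real.norm_eq_abs, Real.abs_exp, ← mul_assoc, ← Real.exp_add]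
      refine le_mul_of_one_le_left (norm_nonneg _) (Real.one_le_exp ?_)
      nlinarith [ht.2]
    refine this.trans ?_
    rw [ENNReal.ofReal_mul (Real.exp_pos _).le, N₂, ENNReal.ofReal_toReal D.memLp₂.2.ne]
    gcongr
    exact Measure.restrict_le_self
  have e₃ : eLpNorm (fun _ : ℝ => z) p ν = ENNReal.ofReal ‖z‖ := by
    rw [eLpNorm_const' z (zero_lt_one.trans_le hp).ne' hp']
    simp [hν, I]
  have e₄ : (fun _ : ℝ => z) = (fun t => j (D.x₁ t)) + D.x₂ := by
    funext t; exact (D.add_eq t).symm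
  have e₅ : ENNReal.ofReal ‖z‖ ≤ ENNReal.ofReal (‖j‖ * D.N₁ + Real.exp (1 - θ) * D.N₂) := by
    rw [ENNReal.ofReal_add (mul_nonneg (norm_nonneg _) D.N₁_nonneg)
      (mul_nonneg (Real.exp_pos _).le D.N₂_nonneg), ← e₃, e₄]
    exact (eLpNorm_add_le (j.continuous.comp_aestronglyMeasurable hm₁).restrict hm₂.restrict
      hp).trans (add_le_add e₁ e₂)
  exact (ENNReal.ofReal_le_ofReal_iff (add_nonneg (mul_nonneg (norm_nonneg _) D.N₁_nonneg)
      (mul_nonneg (Real.exp_pos _).le D.N₂_nonneg))).1 e₅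

/-- Image of a representation under an operator that is bounded on both spaces of the pair. -/
def map (T₀ : A₀ →L[ℝ] A₀) (T₁ : A₁ →L[ℝ] A₁) (h : ∀ a, j (T₀ a) = T₁ (j a))
    (D : Decomp j θ p z) : Decomp j θ p (T₁ z) where
  x₁ := fun t => T₀ (D.x₁ t)
  x₂ := fun t => T₁ (D.x₂ t)
  memLp₁ := (funext fun t => by simp :
    T₀ ∘ (fun t : ℝ => Real.exp (θ * t) • D.x₁ t)
      = fun t : ℝ => Real.exp (θ * t) • T₀ (D.x₁ t)) ▸ T₀.comp_memLp' D.memLp₁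
  memLp₂ := (funext fun t => by simp :
    T₁ ∘ (fun t : ℝ => Real.exp (-(1 - θ) * t) • D.x₂ t)
      = fun t : ℝ => Real.exp (-(1 - θ) * t) • T₁ (D.x₂ t)) ▸ T₁.comp_memLp' D.memLp₂
  add_eq := fun t => by
    have e := D.add_eq t
    rw [h, ← map_add, e]

lemma N₁_map (T₀ : A₀ →L[ℝ] A₀) (T₁ : A₁ →L[ℝ] A₁) (h : ∀ a, j (T₀ a) = T₁ (j a))
    (D : Decomp j θ p z) : (D.map T₀ T₁ h).N₁ ≤ ‖T₀‖ * D.N₁ := by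
  have : eLpNorm (fun t : ℝ => Real.exp (θ * t) • (D.map T₀ T₁ h).x₁ t) p volume
      ≤ ENNReal.ofReal ‖T₀‖ * eLpNorm (fun t : ℝ => Real.exp (θ * t) • D.x₁ t) p volume := by
    apply eLpNorm_le_mul_eLpNorm_of_ae_le_mul
    filter_upwards with t
    have : Real.exp (θ * t) • (D.map T₀ T₁ h).x₁ t = T₀ (Real.exp (θ * t) • D.x₁ t) := by
      simp [map]
    rw [this]
    exact T₀.le_opNorm _
  refine (ENNReal.toReal_mono (ENNReal.mul_ne_top ENNReal.ofReal_ne_top D.memLp₁.2.ne) this).trans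
    (le_of_eq ?_)
  rw [ENNReal.toReal_mul, ENNReal.toReal_ofReal (norm_nonneg _), N₁]

lemma N₂_map (T₀ : A₀ →L[ℝ] A₀) (T₁ : A₁ →L[ℝ] A₁) (h : ∀ a, j (T₀ a) = T₁ (j a))
    (D : Decomp j θ p z) : (D.map T₀ T₁ h).N₂ ≤ ‖T₁‖ * D.N₂ := by
  have : eLpNorm (fun t : ℝ => Real.exp (-(1 - θ) * t) • (D.map T₀ T₁ h).x₂ t) p volume
      ≤ ENNReal.ofReal ‖T₁‖ *
        eLpNorm (fun t : ℝ => Real.exp (-(1 - θ) * t) • D.x₂ t) p volume := by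
    apply eLpNorm_le_mul_eLpNorm_of_ae_le_mul
    filter_upwards with t
    have : Real.exp (-(1 - θ) * t) • (D.map T₀ T₁ h).x₂ t
        = T₁ (Real.exp (-(1 - θ) * t) • D.x₂ t) := by
      simp [map]
    rw [this]
    exact T₁.le_opNorm _
  refine (ENNReal.toReal_mono (ENNReal.mul_ne_top ENNReal.ofReal_ne_top D.memLp₂.2.ne) this).trans
    (le_of_eq ?_)
  rw [ENNReal.toReal_mul, ENNReal.toReal_ofReal (norm_nonneg _), N₂]

lemma value_map (h0 : 0 < θ) (h1 : θ < 1) (T₀ : A₀ →L[ℝ] A₀) (T₁ : A₁ →L[ℝ] A₁)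
    (h : ∀ a, j (T₀ a) = T₁ (j a)) (D : Decomp j θ p z) :
    (D.map T₀ T₁ h).value ≤ (‖T₀‖ ^ (1 - θ) * ‖T₁‖ ^ θ) * D.value := by
  calc (D.map T₀ T₁ h).value ≤ (‖T₀‖ * D.N₁) ^ (1 - θ) * (‖T₁‖ * D.N₂) ^ θ :=
        mul_le_mul (Real.rpow_le_rpow (N₁_nonneg _) (N₁_map T₀ T₁ h D) (by linarith))
          (Real.rpow_le_rpow (N₂_nonneg _) (N₂_map T₀ T₁ h D) h0.le)
          (Real.rpow_nonneg (N₂_nonneg _) _)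
          (Real.rpow_nonneg (mul_nonneg (norm_nonneg _) D.N₁_nonneg) _)
    _ = _ := by
      rw [Real.mul_rpow (norm_nonneg _) D.N₁_nonneg, Real.mul_rpow (norm_nonneg _) D.N₂_nonneg,
        value]
      ring

end Decomp

variable (j : A₀ →L[ℝ] A₁) (θ : Ioo (0 : ℝ) 1) (p : Ioo (1 : ℝ≥0∞) ⊤)

/-- The subspace of all `z ∈ A₀ + A₁ = A₁` that admit a representation. -/
def interpSubmodule : Submodule ℝ A₁ where
  carrier := {z | Nonempty (Decomp j θ p z)}
  add_mem' := fun ⟨D⟩ ⟨E⟩ => ⟨D.add E⟩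
  zero_mem' := ⟨Decomp.zero j θ p⟩
  smul_mem' := fun c _ ⟨D⟩ => ⟨D.smul c⟩

/-- The interpolation space `[A₀, A₁]_{θ,p}`, with the norm below (not the norm of `A₁`). -/
def InterpSpace : Type _ := ↥(interpSubmodule j θ p)

namespace InterpSpace

instance : AddCommGroup (InterpSpace j θ p) :=
  inferInstanceAs (AddCommGroup ↥(interpSubmodule j θ p))

instance : Module ℝ (InterpSpace j θ p) :=
  inferInstanceAs (Module ℝ ↥(interpSubmodule j θ p))

/-- The infimum of `‖e^{θt} x₁(t)‖_p^{1-θ} ‖e^{-(1-θ)t} x₂(t)‖_p^θ` over all representations. -/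
instance : Norm (InterpSpace j θ p) := ⟨fun z => ⨅ D : Decomp j θ p z.1, D.value⟩

variable {j θ p}

instance (z : InterpSpace j θ p) : Nonempty (Decomp j θ p z.1) := z.2

lemma norm_def (z : InterpSpace j θ p) : ‖z‖ = ⨅ D : Decomp j θ p z.1, D.value := rfl

lemma norm_le_value (z : InterpSpace j θ p) (D : Decomp j θ p z.1) : ‖z‖ ≤ D.value :=
  ciInf_le ⟨0, by rintro _ ⟨E, rfl⟩; exact E.value_nonneg⟩ D

lemma norm_nonneg' (z : InterpSpace j θ p) : 0 ≤ ‖z‖ := Real.iInf_nonneg fun D => D.value_nonneg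

lemma exists_of_norm_lt (z : InterpSpace j θ p) {c : ℝ} (h : ‖z‖ < c) :
    ∃ D : Decomp j θ p z.1, D.N₁ < c ∧ D.N₂ < c := by
  obtain ⟨D, hD⟩ := exists_lt_of_ciInf_lt h
  exact D.exists_lt θ.2.1 θ.2.2 hD

lemma norm_smul_le' (c : ℝ) (z : InterpSpace j θ p) : ‖c • z‖ ≤ |c| * ‖z‖ := by
  rw [norm_def z, Real.mul_iInf_of_nonneg (abs_nonneg c)]
  refine le_ciInf fun D => ?_
  rw [← D.value_smul]
  exact norm_le_value (c • z) (D.smul c)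

lemma norm_add_le' (z w : InterpSpace j θ p) : ‖z + w‖ ≤ ‖z‖ + ‖w‖ := by
  refine le_of_forall_pos_lt_add fun ε hε => ?_
  obtain ⟨D, hD₁, hD₂⟩ := exists_of_norm_lt z (lt_add_of_pos_right ‖z‖ (half_pos hε))
  obtain ⟨E, hE₁, hE₂⟩ := exists_of_norm_lt w (lt_add_of_pos_right ‖w‖ (half_pos hε))
  obtain ⟨c, hc₁, hc₂⟩ : ∃ c, max (D.add E).N₁ (D.add E).N₂ ≤ c ∧ c < ‖z‖ + ‖w‖ + ε := by
    refine ⟨_, le_rfl, max_lt ?_ ?_⟩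
    · have := D.N₁_add p.2.1.le E; linarith
    · have := D.N₂_add p.2.1.le E; linarith
  refine lt_of_le_of_lt ?_ hc₂
  exact (norm_le_value (z + w) (D.add E)).trans ((D.add E).value_le θ.2.1 θ.2.2
    ((le_max_left _ _).trans hc₁) ((le_max_right _ _).trans hc₁))

lemma norm_val_le (z : InterpSpace j θ p) : ‖z.1‖ ≤ (‖j‖ + Real.exp (1 - θ)) * ‖z‖ := by
  have hpos : 0 < ‖j‖ + Real.exp (1 - (θ : ℝ)) :=
    add_pos_of_nonneg_of_pos (norm_nonneg _) (Real.exp_pos _)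
  rw [← div_le_iff₀' hpos]
  refine le_of_forall_gt fun c hc => ?_
  obtain ⟨D, h₁, h₂⟩ := exists_of_norm_lt z hc
  rw [div_lt_iff₀' hpos]
  refine (D.norm_le θ.2.1 θ.2.2 p.2.1.le p.2.2.ne).trans_lt ?_
  rw [add_mul]
  exact add_lt_add_of_le_of_lt (mul_le_mul_of_nonneg_left h₁.le (norm_nonneg _))
    (mul_lt_mul_of_pos_left h₂ (Real.exp_pos _))

lemma core : NormedSpace.Core ℝ (InterpSpace j θ p) where
  norm_nonneg := norm_nonneg'
  norm_smul c z := by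
    rw [Real.norm_eq_abs]
    refine le_antisymm (norm_smul_le' c z) ?_
    rcases eq_or_ne c 0 with rfl | hc
    · simpa using norm_nonneg' _
    · have h := norm_smul_le' c⁻¹ (c • z)
      rw [inv_smul_smul₀ hc, abs_inv] at h
      rwa [← le_inv_mul_iff₀ (abs_pos.2 hc)]
  norm_triangle := norm_add_le'
  norm_eq_zero_iff z := by
    constructor
    · intro h
      have := norm_val_le z
      rw [h, mul_zero] at this
      exact Subtype.ext (norm_le_zero_iff.1 this)
    · rintro rfl
      refine le_antisymm ?_ (norm_nonneg' _)
      simpa using norm_smul_le' (j := j) (θ := θ) (p := p) 0 0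

instance : NormedAddCommGroup (InterpSpace j θ p) := NormedAddCommGroup.ofCore core

instance : NormedSpace ℝ (InterpSpace j θ p) := NormedSpace.ofCore core

/-- The linear map on `[A₀, A₁]_{θ,p}` induced by an operator that is bounded on both `A₀` and
`A₁`. -/
def mapLM (T₀ : A₀ →L[ℝ] A₀) (T₁ : A₁ →L[ℝ] A₁) (h : ∀ a, j (T₀ a) = T₁ (j a)) :
    InterpSpace j θ p →ₗ[ℝ] InterpSpace j θ p where
  toFun z := ⟨T₁ z.1, z.2.elim fun D => ⟨D.map T₀ T₁ h⟩⟩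
  map_add' z w := Subtype.ext (map_add T₁ z.1 w.1)
  map_smul' c z := Subtype.ext (map_smul T₁ c z.1)

lemma norm_mapLM_le (T₀ : A₀ →L[ℝ] A₀) (T₁ : A₁ →L[ℝ] A₁) (h : ∀ a, j (T₀ a) = T₁ (j a))
    (z : InterpSpace j θ p) :
    ‖mapLM T₀ T₁ h z‖ ≤ ‖T₀‖ ^ (1 - (θ : ℝ)) * ‖T₁‖ ^ (θ : ℝ) * ‖z‖ := by
  have hM : 0 ≤ ‖T₀‖ ^ (1 - (θ : ℝ)) * ‖T₁‖ ^ (θ : ℝ) := by positivity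
  rw [norm_def z, Real.mul_iInf_of_nonneg hM]
  refine le_ciInf fun D => ?_
  exact (norm_le_value (mapLM T₀ T₁ h z) (D.map T₀ T₁ h)).trans
    (D.value_map θ.2.1 θ.2.2 T₀ T₁ h)

/-- The bounded operator on `[A₀, A₁]_{θ,p}` induced by an operator that is bounded on both `A₀`
and `A₁`. -/
def mapCLM (T₀ : A₀ →L[ℝ] A₀) (T₁ : A₁ →L[ℝ] A₁) (h : ∀ a, j (T₀ a) = T₁ (j a)) :
    InterpSpace j θ p →L[ℝ] InterpSpace j θ p :=
  (mapLM T₀ T₁ h).mkContinuous _ (norm_mapLM_le T₀ T₁ h)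

end InterpSpace

end Interpolation

/-! ### Types and stability -/

section Types

variable {X : Type*} [NormedAddCommGroup X]

/-- The sequence `(xₙ)` is type determining and realizes the type `σ`:
`σ(y) = lim ‖y + xₙ‖` for all `y`. -/
def Determines (x : ℕ → X) (σ : X → ℝ) : Prop :=
  ∀ y, Tendsto (fun n => ‖y + x n‖) atTop (𝓝 (σ y))

variable (X) in
/-- The set of all types on `X`. -/
def TypeSpace : Type _ := {σ : X → ℝ // ∃ x : ℕ → X, Determines x σ}

variable (X) in
/-- Stability: `lim_n lim_m ‖xₙ + yₘ‖ = lim_m lim_n ‖xₙ + yₘ‖` for all type determining sequences.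
If `(xₙ)` determines `σ` and `(yₘ)` determines `τ`, the inner limits are `τ(xₙ)` and `σ(yₘ)`. -/
def Stable : Prop :=
  ∀ (x y : ℕ → X) (σ τ : X → ℝ), Determines x σ → Determines y τ →
    ∃ l : ℝ, Tendsto (fun n => τ (x n)) atTop (𝓝 l) ∧ Tendsto (fun m => σ (y m)) atTop (𝓝 l)

/-- Convergence of a sequence of types in the topology `s` of uniform convergence on the bounded
subsets of `X`. -/
def TendstoS (σ : ℕ → TypeSpace X) (τ : TypeSpace X) : Prop :=
  ∀ B : Set X, Bornology.IsBounded B → TendstoUniformlyOn (fun n => (σ n).1) τ.1 atTop B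

end Types

/-! ### The reflexive space `R` and the translations -/

section Space

variable (X : Type*) [NormedAddCommGroup X] [NormedSpace ℝ X] [MeasurableSpace X] [BorelSpace X]

instance instFinVar (μ : SignedMeasure X) : IsFiniteMeasure μ.variation := by
  rw [← SignedMeasure.totalVariation_eq_variation]
  infer_instance

variable {X}

lemma exp_cont (y : X) : Continuous fun x : X => Real.exp (-‖x - y‖) := by fun_prop

lemma exp_norm_le (x y : X) : ‖Real.exp (-‖x - y‖)‖ ≤ 1 := by
  rw [Real.norm_eq_abs, Real.abs_exp]
  exact Real.exp_le_one_iff.2 (by simp)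

lemma exp_integrable (μ : SignedMeasure X) (y : X) :
    μ.Integrable fun x : X => Real.exp (-‖x - y‖) :=
  Integrable.of_bound (exp_cont y).aestronglyMeasurable 1
    (Eventually.of_forall fun x => exp_norm_le x y)

lemma abs_integral_le (μ : SignedMeasure X) (y : X) :
    ‖∫ᵛ x, Real.exp (-‖x - y‖) ∂•μ‖ ≤ μ.variation.real univ := by
  have := VectorMeasure.norm_integral_le_of_norm_le_const (μ := μ)
    (B := ContinuousLinearMap.lsmul ℝ ℝ) (f := fun x : X => Real.exp (-‖x - y‖)) (C := 1)
    (Eventually.of_forall fun x => exp_norm_le x y)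
  simpa using this

/-- `Φ(μ)(y) = ∫ e^{-‖x - y‖} μ(dx)`, as a bounded continuous function. -/
def PhiFun (μ : SignedMeasure X) : X →ᵇ ℝ :=
  BoundedContinuousFunction.ofNormedAddCommGroup (fun y => ∫ᵛ x, Real.exp (-‖x - y‖) ∂•μ)
    (VectorMeasure.continuous_of_dominated (bound := fun _ => 1)
      (fun y => (exp_cont y).aestronglyMeasurable)
      (fun y => Eventually.of_forall fun x => exp_norm_le x y)
      (integrable_const 1)
      (Eventually.of_forall fun x => by fun_prop))
    (μ.variation.real univ) (abs_integral_le μ)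

variable (X) in
/-- The operator `Φ : M(X) → C_b(X)`. Here `M(X)` is the space of signed Borel measures on `X`
(all of which are Radon measures when `X` is a separable Banach space), with the total variation
norm. -/
def Phi : SignedMeasure X →ₗ[ℝ] (X →ᵇ ℝ) where
  toFun := PhiFun
  map_add' μ ν := by
    ext y
    exact VectorMeasure.integral_add_vectorMeasure (exp_integrable μ y) (exp_integrable ν y)
  map_smul' c μ := by
    ext y
    exact VectorMeasure.integral_smul_vectorMeasure _ c

variable (X) in
/-- The vector space `Φ(M(X))`, with the norm below (not the norm of `C_b(X)`). -/
def A0 : Type _ := ↥(LinearMap.range (Phi X))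

namespace A0

instance : AddCommGroup (A0 X) := inferInstanceAs (AddCommGroup ↥(LinearMap.range (Phi X)))

instance : Module ℝ (A0 X) := inferInstanceAs (Module ℝ ↥(LinearMap.range (Phi X)))

variable (X) in
/-- The set `Φ(Ba M(X))`, where `Ba M(X)` is the unit ball for the total variation norm. -/
def ball : Set (A0 X) := {f | ∃ μ : SignedMeasure X, μ.variation.real univ ≤ 1 ∧ Phi X μ = f.1}

/-- The gauge of `Φ(Ba M(X))`. -/
instance : Norm (A0 X) := ⟨gauge (ball X)⟩

lemma var_smul (c : ℝ) (μ : SignedMeasure X) :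
    (c • μ).variation.real univ = |c| * μ.variation.real univ := by
  simp [VectorMeasure.variation_smul]

lemma var_add (μ ν : SignedMeasure X) :
    (μ + ν).variation.real univ ≤ μ.variation.real univ + ν.variation.real univ := by
  rw [← measureReal_add_apply]
  exact ENNReal.toReal_mono (measure_ne_top _ _) (VectorMeasure.variation_add_le univ)

lemma balanced_ball : Balanced ℝ (ball X) := by
  rintro a ha _ ⟨f, ⟨μ, hμ, hf⟩, rfl⟩
  refine ⟨a • μ, ?_, ?_⟩
  · rw [var_smul]
    exact mul_le_one₀ ha measureReal_nonneg hμ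
  · rw [map_smul, hf]; rfl

lemma convex_ball : Convex ℝ (ball X) := by
  rintro f ⟨μ, hμ, hf⟩ g ⟨ν, hν, hg⟩ a b ha hb hab
  refine ⟨a • μ + b • ν, ?_, ?_⟩
  · refine (var_add _ _).trans ?_
    rw [var_smul, var_smul, abs_of_nonneg ha, abs_of_nonneg hb]
    nlinarith
  · rw [map_add, map_smul, map_smul, hf, hg]; rfl

lemma absorbent_ball : Absorbent ℝ (ball X) := by
  rw [absorbent_iff_inv_smul]
  intro f
  obtain ⟨μ, hμ⟩ := f.2
  have hc : ∀ᶠ c : ℝ in Bornology.cobounded ℝ, μ.variation.real univ ≤ ‖c‖ :=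
    tendsto_norm_cobounded_atTop.eventually_ge_atTop _
  filter_upwards [hc, Bornology.eventually_ne_cobounded (0 : ℝ)] with c hc h0
  refine ⟨c⁻¹ • μ, ?_, ?_⟩
  · rw [var_smul, abs_inv, ← Real.norm_eq_abs]
    exact inv_mul_le_one_of_le₀ hc (norm_nonneg _)
  · rw [map_smul, hμ]; rfl

lemma norm_val_le (f : A0 X) : ‖f.1‖ ≤ ‖f‖ := by
  refine le_of_forall_gt fun c hc => ?_
  obtain ⟨b, hb, hbc, g, ⟨μ, hμ, hg⟩, rfl⟩ := exists_lt_of_gauge_lt absorbent_ball hc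
  refine lt_of_le_of_lt ?_ hbc
  change ‖b • g.1‖ ≤ b
  rw [norm_smul, Real.norm_of_nonneg hb.le, ← hg]
  refine mul_le_of_le_one_right hb.le ?_
  refine (BoundedContinuousFunction.norm_le zero_le_one).2 fun y => ?_
  exact (abs_integral_le μ y).trans hμ

lemma core : NormedSpace.Core ℝ (A0 X) where
  norm_nonneg := gauge_nonneg
  norm_smul := gauge_smul balanced_ball
  norm_triangle := gauge_add_le convex_ball absorbent_ball
  norm_eq_zero_iff f := by
    constructor
    · intro h
      have := norm_val_le f
      rw [h] at this
      exact Subtype.ext (norm_le_zero_iff.1 this)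
    · rintro rfl
      exact gauge_zero

instance : NormedAddCommGroup (A0 X) := NormedAddCommGroup.ofCore core

instance : NormedSpace ℝ (A0 X) := NormedSpace.ofCore core

variable (X) in
/-- The embedding of `A₀` into `A₁ = C_b(X)`. -/
def incl : A0 X →L[ℝ] (X →ᵇ ℝ) :=
  LinearMap.mkContinuous
    { toFun := fun f => f.1
      map_add' := fun _ _ => rfl
      map_smul' := fun _ _ => rfl } 1 fun f => (norm_val_le f).trans_eq (one_mul _).symm

end A0

variable (X) in
/-- The space `R = [A₀, A₁]_{θ,p}`. -/
abbrev R (θ : Ioo (0 : ℝ) 1) (p : Ioo (1 : ℝ≥0∞) ⊤) : Type _ := InterpSpace (A0.incl X) θ p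

/-- The translation `T_z f (x) = f (x - z)` on `C_b(X)`. -/
def transCb (z : X) : (X →ᵇ ℝ) →L[ℝ] (X →ᵇ ℝ) :=
  LinearMap.mkContinuous
    { toFun := fun f => f.compContinuous ⟨fun x => x - z, by fun_prop⟩
      map_add' := fun _ _ => rfl
      map_smul' := fun _ _ => rfl } 1 fun f => by
    rw [one_mul]
    exact (BoundedContinuousFunction.norm_le (norm_nonneg _)).2 fun x => f.norm_coe_le_norm (x - z)

lemma transCb_Phi (z : X) (μ : SignedMeasure X) :
    Phi X (μ.map fun x => x + z) = transCb z (Phi X μ) := by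
  ext y
  have h := (Homeomorph.addRight z).measurableEmbedding.integral_map_vectorMeasure (μ := μ)
    (B := ContinuousLinearMap.lsmul ℝ ℝ) (f := fun x : X => Real.exp (-‖x - y‖))
  have e : ∀ x : X, x + z - y = x - (y - z) := fun x => by abel
  simp only [Homeomorph.coe_addRight, e] at h
  exact h

lemma var_map_le (z : X) (μ : SignedMeasure X) :
    (μ.map fun x => x + z).variation.real univ ≤ μ.variation.real univ := by
  have h := VectorMeasure.variation_map_le (μ := μ) (φ := fun x : X => x + z) univ
  rw [Measure.map_apply (by fun_prop : Continuous fun x : X => x + z).measurable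
    MeasurableSet.univ, preimage_univ] at h
  exact ENNReal.toReal_mono (measure_ne_top _ _) h

/-- The translation `T_z` on `A₀`. -/
def transA0 (z : X) : A0 X →L[ℝ] A0 X :=
  LinearMap.mkContinuous
    { toFun := fun f => ⟨transCb z f.1, f.2.elim fun μ hμ =>
        ⟨μ.map fun x => x + z, by rw [transCb_Phi, hμ]⟩⟩
      map_add' := fun f g => Subtype.ext (map_add (transCb z) f.1 g.1)
      map_smul' := fun c f => Subtype.ext (map_smul (transCb z) c f.1) } 1 fun f => by
    rw [one_mul]
    refine le_of_forall_gt fun c hc => ?_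
    obtain ⟨b, hb, hbc, g, ⟨μ, hμ, hg⟩, rfl⟩ := exists_lt_of_gauge_lt A0.absorbent_ball hc
    refine lt_of_le_of_lt (gauge_le_of_mem hb.le ?_) hbc
    have hz : Phi X (μ.map fun x => x + z) = transCb z g.1 := by rw [transCb_Phi, hg]
    exact ⟨⟨transCb z g.1, ⟨_, hz⟩⟩, ⟨_, (var_map_le z μ).trans hμ, hz⟩,
      Subtype.ext (map_smul (transCb z) b g.1).symm⟩

/-- The translation operator `T_z` on `R`. -/
def trans (θ : Ioo (0 : ℝ) 1) (p : Ioo (1 : ℝ≥0∞) ⊤) (z : X) : R X θ p →L[ℝ] R X θ p :=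
  InterpSpace.mapCLM (transA0 z) (transCb z) fun _ => rfl

/-- `T` is the representation of the types on `X`: whenever `(xₙ)` determines the type `σ`, the
operator `T_σ` is the limit of the translations `T_{xₙ}` in the weak operator topology of `R`. -/
def IsRepresentation (θ : Ioo (0 : ℝ) 1) (p : Ioo (1 : ℝ≥0∞) ⊤)
    (T : TypeSpace X → (R X θ p →L[ℝ] R X θ p)) : Prop :=
  ∀ (σ : TypeSpace X) (x : ℕ → X), Determines x σ.1 →
    ∀ (r : R X θ p) (r' : StrongDual ℝ (R X θ p)),
      Tendsto (fun n => r' (trans θ p (x n) r)) atTop (𝓝 (r' (T σ r)))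

end Space

end StableRep

end

noncomputable section

namespace StableRep

section Exponentials

lemma memLp_indicator_Iio_exp {a : ℝ} (ha : 0 < a) {p : ℝ≥0∞} (hp : p ≠ 0) (hp' : p ≠ ⊤) (s : ℝ) :
    MemLp ((Iio s).indicator fun t : ℝ => Real.exp (a * t)) p volume := by
  rw [memLp_indicator_iff_restrict measurableSet_Iio,
    ← integrable_norm_rpow_iff (by fun_prop) hp hp']
  have h := (integrableOn_exp_mul_Iic (mul_pos ha (ENNReal.toReal_pos hp hp')) s).mono_set
    (Iio_subset_Iic_self : Iio s ⊆ Iic s)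
  refine h.congr (Eventually.of_forall fun t => ?_)
  simp only [Real.norm_eq_abs, Real.abs_exp, ← Real.exp_mul]
  congr 1; ring

lemma memLp_indicator_Ici_exp {a : ℝ} (ha : 0 < a) {p : ℝ≥0∞} (hp : p ≠ 0) (hp' : p ≠ ⊤) (s : ℝ) :
    MemLp ((Ici s).indicator fun t : ℝ => Real.exp (-a * t)) p volume := by
  rw [memLp_indicator_iff_restrict measurableSet_Ici,
    ← integrable_norm_rpow_iff (by fun_prop) hp hp']
  have h : IntegrableOn (fun t => Real.exp (-(a * p.toReal) * t)) (Ici s) := by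
    rw [integrableOn_Ici_iff_integrableOn_Ioi]
    exact integrableOn_exp_mul_Ioi (neg_neg_of_pos (mul_pos ha (ENNReal.toReal_pos hp hp'))) s
  refine h.congr (Eventually.of_forall fun t => ?_)
  simp only [Real.norm_eq_abs, Real.abs_exp, ← Real.exp_mul]
  congr 1; ring

lemma eLpNorm_indicator_Iio_exp (a : ℝ) (p : ℝ≥0∞) (s : ℝ) :
    eLpNorm ((Iio s).indicator fun t : ℝ => Real.exp (a * t)) p volume
      = ENNReal.ofReal (Real.exp (a * s)) *
        eLpNorm ((Iio 0).indicator fun t : ℝ => Real.exp (a * t)) p volume := by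
  have : ((Iio s).indicator fun t : ℝ => Real.exp (a * t)) = Real.exp (a * s) •
      (((Iio 0).indicator fun t : ℝ => Real.exp (a * t)) ∘ fun t => t + -s) := by
    funext t
    by_cases ht : t < s
    · have h0 : t + -s < 0 := by linarith
      simp only [mem_Iio, ht, indicator_of_mem, Pi.smul_apply, Function.comp, h0, smul_eq_mul,
        ← Real.exp_add]
      congr 1; ring
    · have h0 : ¬ t + -s < 0 := by linarith
      simp [ht, h0]
  rw [this, eLpNorm_const_smul, eLpNorm_comp_measurePreserving
    ((by fun_prop : Continuous fun t : ℝ => Real.exp (a * t)).aestronglyMeasurable.indicator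
      measurableSet_Iio) (measurePreserving_add_right volume (-s))]
  simp [Real.enorm_eq_ofReal (Real.exp_pos _).le]

lemma eLpNorm_indicator_Ici_exp (a : ℝ) (p : ℝ≥0∞) (s : ℝ) :
    eLpNorm ((Ici s).indicator fun t : ℝ => Real.exp (a * t)) p volume
      = ENNReal.ofReal (Real.exp (a * s)) *
        eLpNorm ((Ici 0).indicator fun t : ℝ => Real.exp (a * t)) p volume := by
  have : ((Ici s).indicator fun t : ℝ => Real.exp (a * t)) = Real.exp (a * s) •
      (((Ici 0).indicator fun t : ℝ => Real.exp (a * t)) ∘ fun t => t + -s) := by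
    funext t
    by_cases ht : s ≤ t
    · have h0 : 0 ≤ t + -s := by linarith
      simp only [mem_Ici, ht, indicator_of_mem, Pi.smul_apply, Function.comp, h0, smul_eq_mul,
        ← Real.exp_add]
      congr 1; ring
    · have h0 : ¬ 0 ≤ t + -s := by linarith
      simp only [mem_Ici, ht, not_false_eq_true, indicator_of_notMem, Pi.smul_apply,
        Function.comp, h0, smul_zero]
  rw [this, eLpNorm_const_smul, eLpNorm_comp_measurePreserving
    ((by fun_prop : Continuous fun t : ℝ => Real.exp (a * t)).aestronglyMeasurable.indicator
      measurableSet_Ici) (measurePreserving_add_right volume (-s))]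
  simp [Real.enorm_eq_ofReal (Real.exp_pos _).le]

lemma tendsto_eLpNorm_indicator_Iio {E : Type*} [NormedAddCommGroup E] {p : ℝ≥0∞} (hp : p ≠ 0)
    (hp' : p ≠ ⊤) {F : ℝ → E} (hF : MemLp F p volume) :
    Tendsto (fun s => eLpNorm ((Iio s).indicator F) p volume) atBot (𝓝 0) := by
  have hpos := ENNReal.toReal_pos hp hp'
  set ν : Measure ℝ := volume.withDensity fun t => ‖F t‖ₑ ^ p.toReal
  have hν : IsFiniteMeasure ν := by
    refine ⟨?_⟩
    rw [withDensity_apply _ MeasurableSet.univ, Measure.restrict_univ]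
    exact lintegral_rpow_enorm_lt_top_of_eLpNorm_lt_top hp hp' hF.2
  have h0 : Tendsto (fun s => ν (Iio s)) atBot (𝓝 0) := by
    have h := tendsto_measure_iInter_atBot (μ := ν) (s := fun s : ℝ => Iio s)
      (fun _ => measurableSet_Iio.nullMeasurableSet) (fun _ _ h => Iio_subset_Iio h)
      ⟨0, measure_ne_top _ _⟩
    rwa [iInter_Iio_of_not_bddBelow_range (by simp), measure_empty] at h
  have h1 := h0.ennrpow_const (1 / p.toReal)
  rw [ENNReal.zero_rpow_of_pos (by positivity)] at h1
  refine h1.congr fun s => ?_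
  rw [eLpNorm_indicator_eq_eLpNorm_restrict measurableSet_Iio,
    eLpNorm_eq_lintegral_rpow_enorm_toReal hp hp', withDensity_apply _ measurableSet_Iio]

lemma MemLp.exists_lt_norm_lt {E F : Type*} [NormedAddCommGroup E] [NormedAddCommGroup F]
    {p : ℝ≥0∞} (hp : p ≠ 0) (hp' : p ≠ ⊤) {f : ℝ → E} {g : ℝ → F} (hf : MemLp f p volume)
    (hg : MemLp g p volume) {ε : ℝ} (hε : 0 < ε) (b : ℝ) :
    ∃ s < b, ‖f s‖ < ε ∧ ‖g s‖ < ε := by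
  by_contra! H
  have hε' : (ε.toNNReal) ≠ 0 := by simpa using hε
  have h : Iio b ⊆ {t | ε.toNNReal ≤ ‖f t‖₊} ∪ {t | ε.toNNReal ≤ ‖g t‖₊} := by
    intro s hs
    by_cases h : ‖f s‖ < ε
    · right
      have := H s hs h
      simpa [Real.toNNReal_le_iff_le_coe] using this
    · left
      simpa [Real.toNNReal_le_iff_le_coe] using h
  have := (measure_mono h).trans (measure_union_le (μ := volume) _ _)
  rw [Real.volume_Iio, top_le_iff] at this
  exact (ENNReal.add_ne_top.2 ⟨(hf.meas_ge_lt_top hp hp' hε').ne,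
    (hg.meas_ge_lt_top hp hp' hε').ne⟩) this

end Exponentials

section Embedding

variable {A₀ A₁ : Type*} [NormedAddCommGroup A₀] [NormedSpace ℝ A₀]
  [NormedAddCommGroup A₁] [NormedSpace ℝ A₁]
  {j : A₀ →L[ℝ] A₁} {θ : Ioo (0 : ℝ) 1} {p : Ioo (1 : ℝ≥0∞) ⊤}

namespace InterpSpace

lemma norm_le_of_decomp {z : InterpSpace j θ p} (D : Decomp j θ p z.1) {c : ℝ} (h₁ : D.N₁ ≤ c)
    (h₂ : D.N₂ ≤ c) : ‖z‖ ≤ c :=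
  (norm_le_value z D).trans (D.value_le θ.2.1 θ.2.2 h₁ h₂)

lemma exponent_ne_zero (p : Ioo (1 : ℝ≥0∞) ⊤) : (p : ℝ≥0∞) ≠ 0 := (zero_lt_one.trans p.2.1).ne'

variable (θ p) in
/-- The norm in `L_p` of `e^{θt}` on the negative half line. -/
def leftConst : ℝ :=
  (eLpNorm ((Iio 0).indicator fun t : ℝ => Real.exp (θ * t)) p volume).toReal

variable (θ p) in
/-- The norm in `L_p` of `e^{-(1-θ)t}` on the positive half line. -/
def rightConst : ℝ :=
  (eLpNorm ((Ici 0).indicator fun t : ℝ => Real.exp (-(1 - θ) * t)) p volume).toReal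

lemma leftConst_nonneg : 0 ≤ leftConst θ p := ENNReal.toReal_nonneg
lemma rightConst_nonneg : 0 ≤ rightConst θ p := ENNReal.toReal_nonneg

lemma memLp_left {E : Type*} [NormedAddCommGroup E] [NormedSpace ℝ E] (a : E) (s : ℝ) :
    MemLp ((Iio s).indicator fun t : ℝ => Real.exp (θ * t) • a) p volume := by
  have h := (memLp_indicator_Iio_exp θ.2.1 (exponent_ne_zero p) p.2.2.ne s)
  have e : ((Iio s).indicator fun t : ℝ => Real.exp (θ * t) • a)
      = fun t => ((Iio s).indicator fun t : ℝ => Real.exp (θ * t)) t • a := by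
    funext t; by_cases ht : t < s <;> simp [ht]
  rw [e]
  exact (ContinuousLinearMap.toSpanSingleton ℝ a).comp_memLp' h

lemma memLp_right {E : Type*} [NormedAddCommGroup E] [NormedSpace ℝ E] (a : E) (s : ℝ) :
    MemLp ((Ici s).indicator fun t : ℝ => Real.exp (-(1 - θ) * t) • a) p volume := by
  have h := (memLp_indicator_Ici_exp (sub_pos.2 θ.2.2) (exponent_ne_zero p) p.2.2.ne s)
  have e : ((Ici s).indicator fun t : ℝ => Real.exp (-(1 - θ) * t) • a)
      = fun t => ((Ici s).indicator fun t : ℝ => Real.exp (-(1 - θ) * t)) t • a := by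
    funext t
    by_cases ht : s ≤ t
    · simp only [mem_Ici, ht, indicator_of_mem]
    · simp only [mem_Ici, ht, not_false_eq_true, indicator_of_notMem, zero_smul]
  rw [e]
  exact (ContinuousLinearMap.toSpanSingleton ℝ a).comp_memLp' h

lemma toReal_eLpNorm_left {E : Type*} [NormedAddCommGroup E] [NormedSpace ℝ E] (a : E) (s : ℝ) :
    (eLpNorm ((Iio s).indicator fun t : ℝ => Real.exp (θ * t) • a) p volume).toReal
      ≤ ‖Real.exp (θ * s) • a‖ * leftConst θ p := by
  have h : eLpNorm ((Iio s).indicator fun t : ℝ => Real.exp (θ * t) • a) p volume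
      ≤ ENNReal.ofReal ‖a‖ *
        eLpNorm ((Iio s).indicator fun t : ℝ => Real.exp (θ * t)) p volume := by
    apply eLpNorm_le_mul_eLpNorm_of_ae_le_mul
    refine Eventually.of_forall fun t => ?_
    by_cases ht : t < s <;> simp [ht, norm_smul, mul_comm]
  refine (ENNReal.toReal_mono (ENNReal.mul_ne_top ENNReal.ofReal_ne_top
    (memLp_indicator_Iio_exp θ.2.1 (exponent_ne_zero p) p.2.2.ne s).2.ne) h).trans_eq ?_
  rw [eLpNorm_indicator_Iio_exp, ENNReal.toReal_mul, ENNReal.toReal_mul,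
    ENNReal.toReal_ofReal (norm_nonneg _), ENNReal.toReal_ofReal (Real.exp_pos _).le, norm_smul,
    Real.norm_of_nonneg (Real.exp_pos _).le, leftConst]
  ring

lemma toReal_eLpNorm_right {E : Type*} [NormedAddCommGroup E] [NormedSpace ℝ E] (a : E) (s : ℝ) :
    (eLpNorm ((Ici s).indicator fun t : ℝ => Real.exp (-(1 - θ) * t) • a) p volume).toReal
      ≤ ‖Real.exp (-(1 - θ) * s) • a‖ * rightConst θ p := by
  have h : eLpNorm ((Ici s).indicator fun t : ℝ => Real.exp (-(1 - θ) * t) • a) p volume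
      ≤ ENNReal.ofReal ‖a‖ *
        eLpNorm ((Ici s).indicator fun t : ℝ => Real.exp (-(1 - θ) * t)) p volume := by
    apply eLpNorm_le_mul_eLpNorm_of_ae_le_mul
    refine Eventually.of_forall fun t => ?_
    by_cases ht : s ≤ t
    · simp only [mem_Ici, ht, indicator_of_mem, norm_smul, mul_comm, le_refl]
    · simp only [mem_Ici, ht, not_false_eq_true, indicator_of_notMem, norm_zero, mul_zero, le_refl]
  refine (ENNReal.toReal_mono (ENNReal.mul_ne_top ENNReal.ofReal_ne_top
    (memLp_indicator_Ici_exp (sub_pos.2 θ.2.2) (exponent_ne_zero p) p.2.2.ne s).2.ne) h).trans_eq ?_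
  rw [eLpNorm_indicator_Ici_exp, ENNReal.toReal_mul, ENNReal.toReal_mul,
    ENNReal.toReal_ofReal (norm_nonneg _), ENNReal.toReal_ofReal (Real.exp_pos _).le, norm_smul,
    Real.norm_of_nonneg (Real.exp_pos _).le, rightConst]
  ring

lemma smul_indicator_eq {E : Type*} [NormedAddCommGroup E] [NormedSpace ℝ E] (c : ℝ → ℝ)
    (s : Set ℝ) (f : ℝ → E) :
    (fun t => c t • s.indicator f t) = s.indicator fun t => c t • f t := by
  funext t; by_cases ht : t ∈ s <;> simp [ht]

variable (j θ p) in
/-- The representation of `j a` that equals `a` for `t < 0` and `j a` for `t ≥ 0`. -/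
def splitDecomp (a : A₀) : Decomp j θ p (j a) where
  x₁ := (Iio 0).indicator fun _ => a
  x₂ := (Ici 0).indicator fun _ => j a
  memLp₁ := by
    rw [smul_indicator_eq (fun t : ℝ => Real.exp (θ * t)) (Iio 0)]
    exact memLp_left a 0
  memLp₂ := by
    rw [smul_indicator_eq (fun t : ℝ => Real.exp (-(1 - θ) * t)) (Ici 0)]
    exact memLp_right (j a) 0
  add_eq t := by
    by_cases ht : t < 0
    · simp [ht]
    · simp [ht, not_lt.1 ht]

variable (j θ p) in
/-- The embedding of `A₀` into the interpolation space. -/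
def embed : A₀ →ₗ[ℝ] InterpSpace j θ p where
  toFun a := ⟨j a, ⟨splitDecomp j θ p a⟩⟩
  map_add' a b := Subtype.ext (map_add j a b)
  map_smul' c a := Subtype.ext (map_smul j c a)

@[simp] lemma embed_val (a : A₀) : (embed j θ p a).1 = j a := rfl

lemma norm_embed_le (a : A₀) :
    ‖embed j θ p a‖ ≤ (leftConst θ p ^ (1 - (θ : ℝ)) * rightConst θ p ^ (θ : ℝ)) *
      (‖a‖ ^ (1 - (θ : ℝ)) * ‖j a‖ ^ (θ : ℝ)) := by
  have h₁ : (splitDecomp j θ p a).N₁ ≤ ‖a‖ * leftConst θ p := by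
    have h := toReal_eLpNorm_left (θ := θ) (p := p) a 0
    rw [← smul_indicator_eq (fun t : ℝ => Real.exp (θ * t)) (Iio 0), mul_zero, Real.exp_zero,
      one_smul] at h
    exact h
  have h₂ : (splitDecomp j θ p a).N₂ ≤ ‖j a‖ * rightConst θ p := by
    have h := toReal_eLpNorm_right (θ := θ) (p := p) (j a) 0
    rw [← smul_indicator_eq (fun t : ℝ => Real.exp (-(1 - θ) * t)) (Ici 0), mul_zero,
      Real.exp_zero, one_smul] at h
    exact h
  have hθ := θ.2.1
  have hθ' := sub_pos.2 θ.2.2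
  have hl := leftConst_nonneg (θ := θ) (p := p)
  have hr := rightConst_nonneg (θ := θ) (p := p)
  calc ‖embed j θ p a‖ ≤ (splitDecomp j θ p a).value := norm_le_value _ _
    _ ≤ (‖a‖ * leftConst θ p) ^ (1 - (θ : ℝ)) * (‖j a‖ * rightConst θ p) ^ (θ : ℝ) :=
      mul_le_mul (Real.rpow_le_rpow (Decomp.N₁_nonneg _) h₁ hθ'.le)
        (Real.rpow_le_rpow (Decomp.N₂_nonneg _) h₂ hθ.le) (Real.rpow_nonneg (Decomp.N₂_nonneg _) _)
        (by positivity)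
    _ = _ := by
      rw [Real.mul_rpow (norm_nonneg _) hl, Real.mul_rpow (norm_nonneg _) hr]
      ring

lemma denseRange_embed : DenseRange (embed j θ p) := by
  rw [Metric.denseRange_iff]
  intro z ε hε
  obtain ⟨D⟩ := z.2
  have hp0 := exponent_ne_zero p
  have hpt := p.2.2.ne
  set F : ℝ → A₀ := fun t => Real.exp (θ * t) • D.x₁ t with hF
  set G : ℝ → A₁ := fun t => Real.exp (-(1 - θ) * t) • D.x₂ t with hG
  set c := max (leftConst θ p) (rightConst θ p) + 1 with hc
  have hl : leftConst θ p ≤ c := by have := le_max_left (leftConst θ p) (rightConst θ p); linarith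
  have hr : rightConst θ p ≤ c := by
    have := le_max_right (leftConst θ p) (rightConst θ p); linarith
  have hc0 : 0 < c := by
    have := le_max_left (leftConst θ p) (rightConst θ p)
    have := leftConst_nonneg (θ := θ) (p := p); linarith
  have htail : ∀ᶠ s in atBot, eLpNorm ((Iio s).indicator F) p volume < ENNReal.ofReal (ε / 4) ∧
      eLpNorm ((Iio s).indicator G) p volume < ENNReal.ofReal (ε / 4) :=
    ((tendsto_eLpNorm_indicator_Iio hp0 hpt D.memLp₁).eventually_lt_const (by simpa)).and
      ((tendsto_eLpNorm_indicator_Iio hp0 hpt D.memLp₂).eventually_lt_const (by simpa))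
  obtain ⟨b, hb⟩ := eventually_atBot.1 htail
  obtain ⟨s, hs, hs₁, hs₂⟩ := MemLp.exists_lt_norm_lt hp0 hpt D.memLp₁ D.memLp₂
    (ε := ε / 4 / c) (by positivity) b
  obtain ⟨ht₁, ht₂⟩ := hb s hs.le
  have e₁ : (fun t : ℝ => Real.exp (θ * t) • (Iio s).indicator (fun t => D.x₁ t - D.x₁ s) t)
      = (Iio s).indicator F - (Iio s).indicator fun t => Real.exp (θ * t) • D.x₁ s := by
    funext t; by_cases ht : t < s <;> simp [ht, hF, smul_sub]
  have e₂ : (fun t : ℝ => Real.exp (-(1 - θ) * t) •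
        ((Iio s).indicator D.x₂ t + (Ici s).indicator (fun _ => D.x₂ s) t))
      = (Iio s).indicator G + (Ici s).indicator fun t => Real.exp (-(1 - θ) * t) • D.x₂ s := by
    funext t
    by_cases ht : t < s
    · simp [ht, hG]
    · have ht' := not_lt.1 ht
      simp only [mem_Iio, ht, mem_Ici, ht', not_false_eq_true, indicator_of_notMem,
        indicator_of_mem, Pi.add_apply, zero_add]
  have mF := D.memLp₁.indicator (s := Iio s) measurableSet_Iio
  have mG := D.memLp₂.indicator (s := Iio s) measurableSet_Iio
  have mF' := memLp_left (θ := θ) (p := p) (D.x₁ s) s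
  have mG' := memLp_right (θ := θ) (p := p) (D.x₂ s) s
  let E : Decomp j θ p (z - embed j θ p (D.x₁ s)).1 :=
    { x₁ := (Iio s).indicator fun t => D.x₁ t - D.x₁ s
      x₂ := fun t => (Iio s).indicator D.x₂ t + (Ici s).indicator (fun _ => D.x₂ s) t
      memLp₁ := by rw [e₁]; exact mF.sub mF'
      memLp₂ := by rw [e₂]; exact mG.add mG'
      add_eq := fun t => by
        change _ = z.1 - j (D.x₁ s)
        by_cases ht : t < s
        · have ht' := not_le.2 ht
          have := D.add_eq t
          simp only [mem_Iio, ht, mem_Ici, ht', not_false_eq_true, indicator_of_notMem,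
            indicator_of_mem, add_zero, map_sub, ← this]
          abel
        · have ht' := not_lt.1 ht
          have := D.add_eq s
          simp only [mem_Iio, ht, mem_Ici, ht', not_false_eq_true, indicator_of_notMem,
            indicator_of_mem, map_zero, zero_add, ← this]
          abel }
  have h₁ : E.N₁ ≤ ε / 2 := by
    have h : E.N₁ = _ := congrArg (fun f => (eLpNorm f p volume).toReal) e₁
    rw [h]
    calc _ ≤ (eLpNorm ((Iio s).indicator F) p volume).toReal + (eLpNorm ((Iio s).indicator
          fun t => Real.exp (θ * t) • D.x₁ s) p volume).toReal := by
          rw [← ENNReal.toReal_add mF.2.ne mF'.2.ne]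
          exact ENNReal.toReal_mono (ENNReal.add_ne_top.2 ⟨mF.2.ne, mF'.2.ne⟩)
            (eLpNorm_sub_le mF.1 mF'.1 p.2.1.le)
      _ ≤ ε / 4 + ε / 4 / c * c := by
          refine add_le_add (ENNReal.toReal_le_of_le_ofReal (by positivity) ht₁.le) ?_
          exact (toReal_eLpNorm_left _ _).trans
            (mul_le_mul hs₁.le hl leftConst_nonneg (by positivity))
      _ = ε / 2 := by field_simp; norm_num
  have h₂ : E.N₂ ≤ ε / 2 := by
    have h : E.N₂ = _ := congrArg (fun f => (eLpNorm f p volume).toReal) e₂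
    rw [h]
    calc _ ≤ (eLpNorm ((Iio s).indicator G) p volume).toReal + (eLpNorm ((Ici s).indicator
          fun t => Real.exp (-(1 - θ) * t) • D.x₂ s) p volume).toReal := by
          rw [← ENNReal.toReal_add mG.2.ne mG'.2.ne]
          exact ENNReal.toReal_mono (ENNReal.add_ne_top.2 ⟨mG.2.ne, mG'.2.ne⟩)
            (eLpNorm_add_le mG.1 mG'.1 p.2.1.le)
      _ ≤ ε / 4 + ε / 4 / c * c := by
          refine add_le_add (ENNReal.toReal_le_of_le_ofReal (by positivity) ht₂.le) ?_
          exact (toReal_eLpNorm_right _ _).trans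
            (mul_le_mul hs₂.le hr rightConst_nonneg (by positivity))
      _ = ε / 2 := by field_simp; norm_num
  refine ⟨D.x₁ s, ?_⟩
  rw [dist_eq_norm]
  exact (norm_le_of_decomp E h₁ h₂).trans_lt (by linarith)

end InterpSpace

end Embedding

section Completeness

variable {A₀ A₁ : Type*} [NormedAddCommGroup A₀] [NormedSpace ℝ A₀]
  [NormedAddCommGroup A₁] [NormedSpace ℝ A₁]
  {j : A₀ →L[ℝ] A₁} {θ : Ioo (0 : ℝ) 1} {p : Ioo (1 : ℝ≥0∞) ⊤}

lemma exists_tendsto_eLpNorm_of_sum {E : Type*} [NormedAddCommGroup E] [CompleteSpace E]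
    {q : ℝ≥0∞} (hq : 1 ≤ q) {f d : ℕ → ℝ → E} (hf : ∀ n, MemLp (f n) q volume)
    (hd : ∀ n, f (n + 1) = f n + d n)
    (hd' : ∀ n, (eLpNorm (d n) q volume).toReal < (1 / 2) ^ n) :
    ∃ g, MemLp g q volume ∧ Tendsto (fun n => eLpNorm (f n - g) q volume) atTop (𝓝 0) := by
  have : Fact (1 ≤ q) := ⟨hq⟩
  have hc : CauchySeq fun n => (hf n).toLp (f n) := by
    refine cauchySeq_of_le_geometric (1 / 2) 1 (by norm_num) fun n => ?_
    rw [dist_comm, dist_eq_norm, ← MemLp.toLp_sub, Lp.norm_toLp, hd n, add_sub_cancel_left, one_mul]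
    exact (hd' n).le
  obtain ⟨g, hg⟩ := cauchySeq_tendsto_of_complete hc
  refine ⟨g, Lp.memLp g, ?_⟩
  rw [← Lp.tendsto_Lp_iff_tendsto_eLpNorm'' f hf g (Lp.memLp g), Lp.toLp_coeFn]
  exact hg

namespace InterpSpace

lemma exists_tendsto_of_summable [CompleteSpace A₀] [CompleteSpace A₁]
    (u : ℕ → InterpSpace j θ p) (hu : ∀ n, ‖u (n + 1) - u n‖ < (1 / 2) ^ n) :
    ∃ w, Tendsto u atTop (𝓝 w) := by
  obtain ⟨E⟩ := (u 0).2
  choose D hD₁ hD₂ using fun n => exists_of_norm_lt (u (n + 1) - u n) (hu n)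
  let P₁ : ℕ → ℝ → A₀ := fun n t => E.x₁ t + ∑ k ∈ Finset.range n, (D k).x₁ t
  let P₂ : ℕ → ℝ → A₁ := fun n t => E.x₂ t + ∑ k ∈ Finset.range n, (D k).x₂ t
  let f₁ : ℕ → ℝ → A₀ := fun n t => Real.exp (θ * t) • P₁ n t
  let f₂ : ℕ → ℝ → A₁ := fun n t => Real.exp (-(1 - θ) * t) • P₂ n t
  have hs₁ : ∀ n, f₁ (n + 1) = f₁ n + fun t => Real.exp (θ * t) • (D n).x₁ t := fun n => by
    funext t; simp only [f₁, P₁, Finset.sum_range_succ, smul_add, Pi.add_apply, add_assoc]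
  have hs₂ : ∀ n, f₂ (n + 1) = f₂ n + fun t => Real.exp (-(1 - θ) * t) • (D n).x₂ t := fun n => by
    funext t; simp only [f₂, P₂, Finset.sum_range_succ, smul_add, Pi.add_apply, add_assoc]
  have hm₁ : ∀ n, MemLp (f₁ n) p volume := fun n => by
    induction n with
    | zero => simpa [f₁, P₁] using E.memLp₁
    | succ n ih => rw [hs₁]; exact ih.add (D n).memLp₁
  have hm₂ : ∀ n, MemLp (f₂ n) p volume := fun n => by
    induction n with
    | zero => simpa only [f₂, P₂, Finset.range_zero, Finset.sum_empty, add_zero] using E.memLp₂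
    | succ n ih => rw [hs₂]; exact ih.add (D n).memLp₂
  have hP : ∀ n t, j (P₁ n t) + P₂ n t = (u n).1 := fun n t => by
    induction n with
    | zero => simpa [P₁, P₂] using E.add_eq t
    | succ n ih =>
      have h : j ((D n).x₁ t) + (D n).x₂ t = (u (n + 1)).1 - (u n).1 := (D n).add_eq t
      have e : P₁ (n + 1) t = P₁ n t + (D n).x₁ t := by
        simp only [P₁, Finset.sum_range_succ, add_assoc]
      have e' : P₂ (n + 1) t = P₂ n t + (D n).x₂ t := by
        simp only [P₂, Finset.sum_range_succ, add_assoc]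
      rw [e, e', map_add, add_add_add_comm, ih, h, add_sub_cancel]
  obtain ⟨g₁, hg₁, hl₁⟩ := exists_tendsto_eLpNorm_of_sum p.2.1.le hm₁ hs₁ hD₁
  obtain ⟨g₂, hg₂, hl₂⟩ := exists_tendsto_eLpNorm_of_sum p.2.1.le hm₂ hs₂ hD₂
  obtain ⟨z, hz⟩ : ∃ z, Tendsto (fun n => (u n).1) atTop (𝓝 z) := by
    refine cauchySeq_tendsto_of_complete (cauchySeq_of_le_geometric (1 / 2)
      (‖j‖ + Real.exp (1 - θ)) (by norm_num) fun n => ?_)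
    rw [dist_comm, dist_eq_norm]
    exact (norm_val_le (u (n + 1) - u n)).trans (by gcongr; exact (hu n).le)
  obtain ⟨φ, hφ, hae₁⟩ := (tendstoInMeasure_of_tendsto_eLpNorm (exponent_ne_zero p)
    (fun n => (hm₁ n).1) hg₁.1 hl₁).exists_seq_tendsto_ae
  obtain ⟨ψ, hψ, hae₂⟩ := (tendstoInMeasure_of_tendsto_eLpNorm (exponent_ne_zero p)
    (fun n => (hm₂ (φ n)).1) hg₂.1 (hl₂.comp hφ.tendsto_atTop)).exists_seq_tendsto_ae
  have e₁ : (fun t : ℝ => Real.exp (θ * t) • (Real.exp (-(θ * t)) • g₁ t)) = g₁ := by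
    funext t; rw [smul_smul, ← Real.exp_add, add_neg_cancel, Real.exp_zero, one_smul]
  have e₂ : (fun t : ℝ => Real.exp (-(1 - θ) * t) • (z - j (Real.exp (-(θ * t)) • g₁ t)))
      =ᵐ[volume] g₂ := by
    filter_upwards [hae₁, hae₂] with t h₁ h₂
    refine tendsto_nhds_unique ?_ h₂
    have h₃ : Tendsto (fun i => P₁ (φ (ψ i)) t) atTop (𝓝 (Real.exp (-(θ * t)) • g₁ t)) := by
      refine ((h₁.comp hψ.tendsto_atTop).const_smul (Real.exp (-(θ * t)))).congr fun i => ?_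
      simp only [f₁, Function.comp, smul_smul, ← Real.exp_add, neg_add_cancel, Real.exp_zero,
        one_smul]
    refine (((hz.comp (hφ.comp hψ).tendsto_atTop).sub ((j.continuous.tendsto _).comp h₃)).const_smul
      (Real.exp (-(1 - θ) * t))).congr fun i => ?_
    simp only [f₂, Function.comp, ← hP (φ (ψ i)) t, add_sub_cancel_left]
  let W : Decomp j θ p z :=
    { x₁ := fun t => Real.exp (-(θ * t)) • g₁ t
      x₂ := fun t => z - j (Real.exp (-(θ * t)) • g₁ t)
      memLp₁ := by rw [e₁]; exact hg₁
      memLp₂ := hg₂.ae_eq e₂.symm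
      add_eq := fun t => by abel }
  let w : InterpSpace j θ p := ⟨z, ⟨W⟩⟩
  refine ⟨w, ?_⟩
  have q₁ : ∀ n, (fun t : ℝ => Real.exp (θ * t) • (P₁ n t - W.x₁ t)) = f₁ n - g₁ := fun n => by
    funext t; simp only [smul_sub, Pi.sub_apply, f₁]; rw [← congrFun e₁ t]
  have q₂ : ∀ n, (fun t : ℝ => Real.exp (-(1 - θ) * t) • (P₂ n t - W.x₂ t))
      =ᵐ[volume] f₂ n - g₂ := fun n => by
    filter_upwards [e₂] with t ht
    simp only [smul_sub, Pi.sub_apply, f₂, ← ht, W]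
  let V : ∀ n, Decomp j θ p (u n - w).1 := fun n =>
    { x₁ := fun t => P₁ n t - W.x₁ t
      x₂ := fun t => P₂ n t - W.x₂ t
      memLp₁ := by rw [q₁]; exact (hm₁ n).sub hg₁
      memLp₂ := ((hm₂ n).sub hg₂).ae_eq (q₂ n).symm
      add_eq := fun t => by
        change _ = (u n).1 - z
        rw [map_sub, sub_add_sub_comm, hP, W.add_eq] }
  have v₁ : Tendsto (fun n => (V n).N₁) atTop (𝓝 0) := by
    have h := (ENNReal.tendsto_toReal ENNReal.zero_ne_top).comp hl₁
    refine h.congr fun n => ?_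
    exact (congrArg (fun f => (eLpNorm f p volume).toReal) (q₁ n)).symm
  have v₂ : Tendsto (fun n => (V n).N₂) atTop (𝓝 0) := by
    have h := (ENNReal.tendsto_toReal ENNReal.zero_ne_top).comp hl₂
    refine h.congr fun n => ?_
    exact (congrArg ENNReal.toReal (eLpNorm_congr_ae (q₂ n))).symm
  rw [tendsto_iff_norm_sub_tendsto_zero]
  have v₃ := v₁.max v₂
  rw [max_self] at v₃
  exact squeeze_zero (fun n => norm_nonneg _)
    (fun n => norm_le_of_decomp (V n) (le_max_left _ _) (le_max_right _ _)) v₃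

instance [CompleteSpace A₀] [CompleteSpace A₁] : CompleteSpace (InterpSpace j θ p) := by
  refine Metric.complete_of_convergent_controlled_sequences (fun n => (1 / 2) ^ n)
    (fun n => by positivity) fun u hu => exists_tendsto_of_summable u fun n => ?_
  rw [← dist_eq_norm]
  exact hu n (n + 1) n n.le_succ le_rfl

variable (j θ p) in
/-- The embedding of the interpolation space into `A₁`. -/
def val : InterpSpace j θ p →L[ℝ] A₁ :=
  LinearMap.mkContinuous
    { toFun := fun z => z.1
      map_add' := fun _ _ => rfl
      map_smul' := fun _ _ => rfl } (‖j‖ + Real.exp (1 - θ)) norm_val_le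

@[simp] lemma val_apply (z : InterpSpace j θ p) : val j θ p z = z.1 := rfl

variable (θ p) in
/-- The function that controls the norm of the difference of two elements of `A₀` of norm at most
`M` in terms of their distance in `A₁`. -/
def modulus (M d : ℝ) : ℝ :=
  (leftConst θ p ^ (1 - (θ : ℝ)) * rightConst θ p ^ (θ : ℝ)) *
    ((2 * M) ^ (1 - (θ : ℝ)) * d ^ (θ : ℝ))

variable (θ p) in
lemma continuous_modulus (M : ℝ) : Continuous (modulus θ p M) :=
  continuous_const.mul (continuous_const.mul
    (Real.continuous_rpow_const θ.2.1.le))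

variable (θ p) in
lemma modulus_zero (M : ℝ) : modulus θ p M 0 = 0 := by
  simp [modulus, Real.zero_rpow θ.2.1.ne']

lemma norm_embed_sub_le {M : ℝ} {a b : A₀} (ha : ‖a‖ ≤ M) (hb : ‖b‖ ≤ M) :
    ‖embed j θ p a - embed j θ p b‖ ≤ modulus θ p M ‖j a - j b‖ := by
  rw [← map_sub, ← map_sub]
  refine (norm_embed_le (a - b)).trans ?_
  have hθ := θ.2.1
  have hθ' := sub_pos.2 θ.2.2
  have hl := leftConst_nonneg (θ := θ) (p := p)
  have hr := rightConst_nonneg (θ := θ) (p := p)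
  rw [modulus]
  gcongr
  exact (norm_sub_le a b).trans (by linarith)

/-- The elements of the interpolation space that are limits of sequences in the ball of radius `M`
of `A₀`. -/
def ballClosure (j : A₀ →L[ℝ] A₁) (θ : Ioo (0 : ℝ) 1) (p : Ioo (1 : ℝ≥0∞) ⊤) (M : ℝ) :
    Set (InterpSpace j θ p) :=
  closure (embed j θ p '' {a | ‖a‖ ≤ M})

lemma dist_le_modulus {M : ℝ} {z w : InterpSpace j θ p} (hz : z ∈ ballClosure j θ p M)
    (hw : w ∈ ballClosure j θ p M) : ‖z - w‖ ≤ modulus θ p M ‖z.1 - w.1‖ := by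
  have hc : IsClosed {q : InterpSpace j θ p × InterpSpace j θ p |
      ‖q.1 - q.2‖ ≤ modulus θ p M ‖val j θ p q.1 - val j θ p q.2‖} :=
    isClosed_le (by fun_prop) ((continuous_modulus θ p M).comp (by fun_prop))
  have hd : (z, w) ∈ closure ((embed j θ p '' {a | ‖a‖ ≤ M}) ×ˢ (embed j θ p '' {a | ‖a‖ ≤ M})) := by
    rw [closure_prod_eq]; exact ⟨hz, hw⟩
  refine closure_minimal ?_ hc hd
  rintro ⟨_, _⟩ ⟨⟨a, ha, rfl⟩, b, hb, rfl⟩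
  exact norm_embed_sub_le ha hb

lemma exists_mem_ballClosure [CompleteSpace A₀] [CompleteSpace A₁] {M : ℝ} {z : A₁}
    (h : z ∈ closure (j '' {a | ‖a‖ ≤ M})) : ∃ w ∈ ballClosure j θ p M, w.1 = z := by
  obtain ⟨x, hx, hxz⟩ := mem_closure_iff_seq_limit.1 h
  choose a ha hax using hx
  have hax' : (fun n => j (a n)) = x := funext hax
  have hc : CauchySeq fun n => embed j θ p (a n) := by
    have h₁ : Tendsto (fun q : ℕ × ℕ => ‖j (a q.1) - j (a q.2)‖) atTop (𝓝 0) := by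
      have h₂ := hxz.cauchySeq
      rw [← hax', cauchySeq_iff_tendsto_dist_atTop_0] at h₂
      simpa only [dist_eq_norm] using h₂
    have h₂ := ((continuous_modulus θ p M).tendsto 0).comp h₁
    rw [modulus_zero] at h₂
    rw [cauchySeq_iff_tendsto_dist_atTop_0]
    refine squeeze_zero (fun _ => dist_nonneg) (fun q => ?_) h₂
    rw [dist_eq_norm]
    exact norm_embed_sub_le (ha _) (ha _)
  obtain ⟨w, hw⟩ := cauchySeq_tendsto_of_complete hc
  refine ⟨w, mem_closure_of_tendsto hw (Eventually.of_forall fun n => ⟨a n, ha n, rfl⟩), ?_⟩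
  refine tendsto_nhds_unique (((val j θ p).continuous.tendsto w).comp hw) ?_
  rw [← hax'] at hxz
  exact hxz

lemma tendsto_dual_of_convexHull [CompleteSpace A₀] [CompleteSpace A₁] {M : ℝ} {a : ℕ → A₀}
    (ha : ∀ n, ‖a n‖ ≤ M) {z : A₁}
    (h : ∀ φ : ℕ → ℕ, StrictMono φ → z ∈ closure (convexHull ℝ (range fun n => j (a (φ n))))) :
    ∃ w ∈ ballClosure j θ p M, w.1 = z ∧ ∀ r' : StrongDual ℝ (InterpSpace j θ p),
      Tendsto (fun n => r' (embed j θ p (a n))) atTop (𝓝 (r' w)) := by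
  have hconv : Convex ℝ {a : A₀ | ‖a‖ ≤ M} := by
    have : {a : A₀ | ‖a‖ ≤ M} = Metric.closedBall 0 M := by ext; simp
    rw [this]; exact convex_closedBall 0 M
  have hsub : ∀ φ : ℕ → ℕ, convexHull ℝ (range fun n => j (a (φ n)))
      = j '' (convexHull ℝ (range fun n => a (φ n))) := fun φ => by
    have h := j.toLinearMap.image_convexHull (range fun n => a (φ n))
    rw [← range_comp] at h
    exact h.symm
  have hball : ∀ φ : ℕ → ℕ, convexHull ℝ (range fun n => a (φ n)) ⊆ {a : A₀ | ‖a‖ ≤ M} := fun φ =>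
    convexHull_min (range_subset_iff.2 fun n => ha _) hconv
  obtain ⟨w, hw, hwz⟩ := exists_mem_ballClosure (θ := θ) (p := p) (closure_mono
    ((hsub id).trans_subset (image_mono (hball id))) (h id strictMono_id))
  refine ⟨w, hw, hwz, fun r' => ?_⟩
  have key : ∀ (s' : StrongDual ℝ (InterpSpace j θ p)) (ε : ℝ), 0 < ε →
      ∀ᶠ n in atTop, s' (embed j θ p (a n)) < s' w + ε := by
    intro s' ε hε
    by_contra hcon
    obtain ⟨φ, hφ, hφ'⟩ := extraction_of_frequently_atTop (not_eventually.1 hcon)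
    obtain ⟨x, hx, hxz⟩ := mem_closure_iff_seq_limit.1 (h φ hφ)
    rw [hsub] at hx
    choose b hb hbx using hx
    have hlim : Tendsto (fun n => embed j θ p (b n)) atTop (𝓝 w) := by
      rw [tendsto_iff_norm_sub_tendsto_zero]
      have h₁ : Tendsto (fun n => ‖(embed j θ p (b n)).1 - w.1‖) atTop (𝓝 0) := by
        rw [hwz, ← tendsto_iff_norm_sub_tendsto_zero]
        exact hxz.congr fun n => (hbx n).symm
      have h₂ := ((continuous_modulus θ p M).tendsto 0).comp h₁
      rw [modulus_zero] at h₂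
      exact squeeze_zero (fun _ => norm_nonneg _)
        (fun n => dist_le_modulus (subset_closure ⟨b n, hball φ (hb n), rfl⟩) hw) h₂
    have hge : ∀ n, s' w + ε ≤ s' (embed j θ p (b n)) := fun n => by
      have hcv : Convex ℝ {c : A₀ | s' w + ε ≤ (s'.toLinearMap ∘ₗ embed j θ p) c} :=
        convex_halfSpace_ge (s'.toLinearMap ∘ₗ embed j θ p).isLinear _
      have hmem : (range fun n => a (φ n)) ⊆
          {c : A₀ | s' w + ε ≤ (s'.toLinearMap ∘ₗ embed j θ p) c} :=
        range_subset_iff.2 fun n => not_lt.1 (hφ' n)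
      exact convexHull_min hmem hcv (hb n)
    have := ge_of_tendsto' ((s'.continuous.tendsto w).comp hlim) hge
    linarith
  rw [Metric.tendsto_atTop']
  intro ε hε
  obtain ⟨N, hN⟩ := eventually_atTop.1 ((key r' ε hε).and (key (-r') ε hε))
  refine ⟨N, fun n hn => ?_⟩
  obtain ⟨h₁, h₂⟩ := hN n hn.le
  simp only [neg_apply] at h₂
  rw [Real.dist_eq, abs_lt]
  constructor <;> linarith

end InterpSpace

end Completeness

section WeakOperatorLimit

variable {E : Type*} [NormedAddCommGroup E] [NormedSpace ℝ E]

lemma eq_of_forall_dual_eq {v w : E} (h : ∀ f : StrongDual ℝ E, f v = f w) : v = w :=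
  eq_of_sub_eq_zero (SeparatingDual.eq_zero_of_forall_dual_eq_zero (R := ℝ)
    fun f => by rw [map_sub, h, sub_self])

lemma norm_le_of_tendsto_dual {v : ℕ → E} {w : E} {C : ℝ} (hC : 0 ≤ C) (hv : ∀ n, ‖v n‖ ≤ C)
    (h : ∀ f : StrongDual ℝ E, Tendsto (fun n => f (v n)) atTop (𝓝 (f w))) : ‖w‖ ≤ C := by
  refine NormedSpace.norm_le_dual_bound ℝ w hC fun f => ?_
  refine le_of_tendsto' (h f).norm fun n => ?_
  rw [mul_comm]
  exact (f.le_opNorm _).trans (mul_le_mul_of_nonneg_left (hv n) (norm_nonneg _))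

lemma exists_clm_of_tendsto_dual [CompleteSpace E] (U : ℕ → E →L[ℝ] E) (hU : ∀ n v, ‖U n v‖ ≤ ‖v‖)
    {S : Set E} (hS : Dense S) (h : ∀ v ∈ S, ∃ w, ∀ f : StrongDual ℝ E,
      Tendsto (fun n => f (U n v)) atTop (𝓝 (f w))) :
    ∃ T : E →L[ℝ] E, (∀ v, ‖T v‖ ≤ ‖v‖) ∧ ∀ v (f : StrongDual ℝ E),
      Tendsto (fun n => f (U n v)) atTop (𝓝 (f (T v))) := by
  have hall : ∀ v, ∃ w, ∀ f : StrongDual ℝ E, Tendsto (fun n => f (U n v)) atTop (𝓝 (f w)) := by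
    intro v
    obtain ⟨s, hs, hsv⟩ := mem_closure_iff_seq_limit.1 (hS v)
    choose w hw using fun k => h (s k) (hs k)
    have hww : ∀ k l, ‖w k - w l‖ ≤ ‖s k - s l‖ := fun k l => by
      refine norm_le_of_tendsto_dual (norm_nonneg _) (fun n => hU n (s k - s l)) fun f => ?_
      simp only [map_sub]
      exact (hw k f).sub (hw l f)
    have hc : CauchySeq w := by
      have h₁ := hsv.cauchySeq
      rw [cauchySeq_iff_tendsto_dist_atTop_0] at h₁ ⊢
      simp only [dist_eq_norm] at h₁ ⊢
      exact squeeze_zero (fun _ => norm_nonneg _) (fun q => hww q.1 q.2) h₁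
    obtain ⟨w₀, hw₀⟩ := cauchySeq_tendsto_of_complete hc
    refine ⟨w₀, fun f => ?_⟩
    rw [Metric.tendsto_atTop]
    intro ε hε
    have h₁ : Tendsto (fun k => ‖f‖ * ‖v - s k‖) atTop (𝓝 0) := by
      have := (tendsto_const_nhds.sub hsv : Tendsto (fun k => v - s k) atTop (𝓝 (v - v))).norm
      simpa using this.const_mul ‖f‖
    have h₂ : Tendsto (fun k => |f (w k) - f w₀|) atTop (𝓝 0) := by
      have := ((f.continuous.tendsto w₀).comp hw₀).sub_const (f w₀)
      rw [sub_self] at this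
      simpa using this.abs
    obtain ⟨k, hk₁, hk₂⟩ := ((h₁.eventually_lt_const (by positivity : 0 < ε / 3)).and
      (h₂.eventually_lt_const (by positivity : 0 < ε / 3))).exists
    obtain ⟨N, hN⟩ := Metric.tendsto_atTop.1 (hw k f) (ε / 3) (by positivity)
    refine ⟨N, fun n hn => ?_⟩
    have h₃ : |f (U n v) - f (U n (s k))| ≤ ‖f‖ * ‖v - s k‖ := by
      rw [← map_sub, ← map_sub, ← Real.norm_eq_abs]
      exact (f.le_opNorm _).trans (mul_le_mul_of_nonneg_left (hU n _) (norm_nonneg _))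
    have h₄ := hN n hn
    rw [Real.dist_eq] at h₄ ⊢
    rw [abs_lt] at *
    rw [abs_le] at h₃
    constructor <;> linarith [h₃.1, h₃.2, h₄.1, h₄.2, hk₂.1, hk₂.2]
  choose T hT using hall
  have hb : ∀ v, ‖T v‖ ≤ ‖v‖ := fun v =>
    norm_le_of_tendsto_dual (norm_nonneg _) (fun n => hU n v) (hT v)
  let L : E →ₗ[ℝ] E :=
    { toFun := T
      map_add' := fun v w => eq_of_forall_dual_eq fun f => by
        refine tendsto_nhds_unique (hT (v + w) f) ?_
        simp only [map_add]
        exact (hT v f).add (hT w f)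
      map_smul' := fun c v => eq_of_forall_dual_eq fun f => by
        refine tendsto_nhds_unique (hT (c • v) f) ?_
        simp only [map_smul, RingHom.id_apply]
        exact (hT v f).const_smul c }
  exact ⟨L.mkContinuous 1 fun v => (hb v).trans_eq (one_mul _).symm, hb, hT⟩

end WeakOperatorLimit

section SignedMeasures

variable {X : Type*} [MeasurableSpace X]

lemma SignedMeasure.exists_sum (μ : ℕ → SignedMeasure X) [∀ n, IsFiniteMeasure (μ n).variation]
    {c : ℕ → ℝ} (hc : Summable c) (hμ : ∀ n, (μ n).variation.real univ ≤ c n) :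
    ∃ ν : SignedMeasure X, ∀ n, (ν - ∑ k ∈ Finset.range n, μ k).variation.real univ
      ≤ ∑' k, c (k + n) := by
  have hle : ∀ k s, ‖μ k s‖ ≤ c k := fun k s =>
    (VectorMeasure.norm_measure_le_variation (measure_ne_top _ _)).trans
      ((measureReal_mono (subset_univ s)).trans (hμ k))
  have hsum : ∀ s, Summable fun k => μ k s := fun s => hc.of_norm_bounded fun k => hle k s
  let ν : SignedMeasure X :=
    { measureOf' := fun s => ∑' k, μ k s
      empty' := by simp
      not_measurable' := fun s hs => by simp [VectorMeasure.not_measurable _ hs]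
      m_iUnion' := fun f hf hd => by
        have h : Tendsto (fun t : Finset ℕ => ∑' k, ∑ i ∈ t, μ k (f i)) atTop
            (𝓝 (∑' k, μ k (⋃ i, f i))) := by
          refine tendsto_tsum_of_dominated_convergence hc
            (fun k => VectorMeasure.hasSum_of_disjoint_iUnion hf hd)
            (Eventually.of_forall fun t k => ?_)
          rw [← VectorMeasure.of_biUnion_finset (fun i _ i' _ h => hd h) fun i _ => hf i]
          exact hle k _
        refine h.congr fun t => ?_
        exact Summable.tsum_finsetSum fun i _ => hsum (f i) }
  refine ⟨ν, fun n => ?_⟩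
  have hcn : Summable fun k => c (k + n) := (summable_nat_add_iff n).2 hc
  have hv : (ν - ∑ k ∈ Finset.range n, μ k).variation
      ≤ Measure.sum fun k => (μ (k + n)).variation := by
    refine VectorMeasure.variation_le_of_forall_enorm_le fun s hs => ?_
    have e : (ν - ∑ k ∈ Finset.range n, μ k) s = ∑' k, μ (k + n) s := by
      have h := (hsum s).sum_add_tsum_nat_add n
      rw [sub_apply, FunLike.coe_sum, Finset.sum_apply]
      change (∑' k, μ k s) - _ = _
      rw [← h, add_sub_cancel_left]
    rw [e, Measure.sum_apply _ hs]
    refine (enorm_tsum_le_tsum_enorm).trans (ENNReal.tsum_le_tsum fun k => ?_)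
    exact VectorMeasure.enorm_measure_le_variation _ _
  have h0 : ∀ k, 0 ≤ c k := fun k => measureReal_nonneg.trans (hμ k)
  refine ENNReal.toReal_le_of_le_ofReal (tsum_nonneg fun k => h0 _) ((hv univ).trans ?_)
  rw [Measure.sum_apply _ MeasurableSet.univ, ENNReal.ofReal_tsum_of_nonneg (fun k => h0 _) hcn]
  refine ENNReal.tsum_le_tsum fun k => ?_
  exact ENNReal.le_ofReal_iff_toReal_le (measure_ne_top _ _) (h0 _) |>.2 (hμ _)

end SignedMeasures

section A0Complete

variable {X : Type*} [NormedAddCommGroup X] [NormedSpace ℝ X] [MeasurableSpace X] [BorelSpace X]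

namespace A0

lemma norm_le_variation {f : A0 X} {μ : SignedMeasure X} (h : Phi X μ = f.1) :
    ‖f‖ ≤ μ.variation.real univ := by
  refine le_of_forall_gt_imp_ge_of_dense fun c hc => ?_
  have hc0 : 0 < c := measureReal_nonneg.trans_lt hc
  refine gauge_le_of_mem hc0.le ?_
  refine ⟨c⁻¹ • f, ⟨c⁻¹ • μ, ?_, ?_⟩, smul_inv_smul₀ hc0.ne' f⟩
  · rw [var_smul, abs_of_pos (inv_pos.2 hc0)]
    exact inv_mul_le_one_of_le₀ hc.le hc0.le
  · rw [map_smul, h]; rfl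

lemma exists_variation_le {f : A0 X} {c : ℝ} (h : ‖f‖ < c) :
    ∃ μ : SignedMeasure X, μ.variation.real univ ≤ c ∧ Phi X μ = f.1 := by
  obtain ⟨b, hb, hbc, g, ⟨μ, hμ, hg⟩, rfl⟩ := exists_lt_of_gauge_lt absorbent_ball h
  refine ⟨b • μ, ?_, by rw [map_smul, hg]; rfl⟩
  rw [var_smul, abs_of_pos hb]
  exact (mul_le_of_le_one_right hb.le hμ).trans hbc.le

instance : CompleteSpace (A0 X) := by
  refine Metric.complete_of_convergent_controlled_sequences (fun n => (1 / 2) ^ n)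
    (fun n => by positivity) fun u hu => ?_
  have hu' : ∀ n, ‖u (n + 1) - u n‖ < (1 / 2) ^ n := fun n => by
    rw [← dist_eq_norm]; exact hu n (n + 1) n n.le_succ le_rfl
  choose μ hμ hμu using fun n => exists_variation_le (hu' n)
  have hc : Summable fun n : ℕ => ((1 / 2) ^ n : ℝ) := summable_geometric_two
  obtain ⟨ν, hν⟩ := SignedMeasure.exists_sum μ hc hμ
  let w : A0 X := u 0 + ⟨Phi X ν, ν, rfl⟩
  have hw : ∀ n, Phi X (ν - ∑ k ∈ Finset.range n, μ k) = (w - u n).1 := fun n => by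
    have h : ∑ k ∈ Finset.range n, Phi X (μ k) = (u n).1 - (u 0).1 := by
      rw [← Finset.sum_range_sub fun k => (u k).1]
      exact Finset.sum_congr rfl fun k _ => hμu k
    have e : (w - u n).1 = (u 0).1 + Phi X ν - (u n).1 := rfl
    rw [map_sub, map_sum, h, e]
    abel
  refine ⟨w, ?_⟩
  rw [tendsto_iff_norm_sub_tendsto_zero]
  refine squeeze_zero (fun _ => norm_nonneg _) (fun n => ?_) (tendsto_sum_nat_add
    fun n : ℕ => ((1 / 2) ^ n : ℝ))
  rw [norm_sub_rev]
  exact (norm_le_variation (hw n)).trans (hν n)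

end A0

end A0Complete

section ConvexCombinations

open CompactlySupported in
lemma exists_integral_eq_of_nonneg {K : Type*} [TopologicalSpace K] [CompactSpace K] [T2Space K]
    [MeasurableSpace K] [BorelSpace K] (φ : C(K, ℝ) →ₗ[ℝ] ℝ) (hφ : ∀ h, 0 ≤ h → 0 ≤ φ h) :
    ∃ μ : Measure K, IsFiniteMeasure μ ∧ ∀ h : C(K, ℝ), φ h = ∫ k, h k ∂μ := by
  let L : C_c(K, ℝ) →ₗ[ℝ] ℝ :=
    { toFun := fun h => φ h.toContinuousMap
      map_add' := fun h h' => map_add φ h.toContinuousMap h'.toContinuousMap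
      map_smul' := fun c h => map_smul φ c h.toContinuousMap }
  let Λ : C_c(K, ℝ) →ₚ[ℝ] ℝ := PositiveLinearMap.mk₀ L fun h hh => hφ _ hh
  refine ⟨RealRMK.rieszMeasure Λ, inferInstance, fun h => ?_⟩
  exact (RealRMK.integral_rieszMeasure Λ (CompactlySupportedContinuousMap.continuousMapEquiv h)).symm

lemma exists_convexHull_lt_of_tendsto {K : Type*} [TopologicalSpace K] [CompactSpace K] [T2Space K]
    (G : ℕ → C(K, ℝ)) {M : ℝ} (hM : ∀ n k, ‖G n k‖ ≤ M)
    (hG : ∀ k, Tendsto (fun n => G n k) atTop (𝓝 0)) {ε : ℝ} (hε : 0 < ε) :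
    ∃ h ∈ convexHull ℝ (range G), ∀ k, h k < ε := by
  borelize K
  let O : Set C(K, ℝ) := {h | MapsTo h univ (Iio ε)}
  have hO : IsOpen O := ContinuousMap.isOpen_setOfPred_mapsTo isCompact_univ isOpen_Iio
  have hOc : Convex ℝ O := fun f hf g hg a b ha hb hab k hk =>
    convex_Iio ε (hf hk) (hg hk) ha hb hab
  by_contra! hcon
  have hd : Disjoint O (convexHull ℝ (range G)) := by
    rw [Set.disjoint_left]
    intro h hh hh'
    obtain ⟨k, hk⟩ := hcon h hh'
    exact not_lt.2 hk (hh (mem_univ k))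
  obtain ⟨φ, u, hφO, hφG⟩ := geometric_hahn_banach_open hOc hO (convex_convexHull ℝ (range G)) hd
  have hu : 0 < u := by
    have := hφO 0 fun k _ => hε
    simpa using this
  have hpos : ∀ h : C(K, ℝ), 0 ≤ h → 0 ≤ φ h := by
    intro h hh
    by_contra! hneg
    have hmem : (u / φ h) • h ∈ O := fun k _ => by
      have h1 : u / φ h ≤ 0 := div_nonpos_of_nonneg_of_nonpos hu.le hneg.le
      have h2 : (u / φ h) * h k ≤ 0 := mul_nonpos_of_nonpos_of_nonneg h1 (hh k)
      exact h2.trans_lt hε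
    have h3 := hφO _ hmem
    rw [map_smul, smul_eq_mul, div_mul_cancel₀ _ hneg.ne] at h3
    exact lt_irrefl _ h3
  obtain ⟨μ, hμ, hμφ⟩ := exists_integral_eq_of_nonneg φ.toLinearMap hpos
  have hlim : Tendsto (fun n => ∫ k, G n k ∂μ) atTop (𝓝 (∫ _, (0 : ℝ) ∂μ)) :=
    tendsto_integral_of_dominated_convergence (fun _ => M)
      (fun n => (G n).continuous.aestronglyMeasurable) (integrable_const M)
      (fun n => Eventually.of_forall (hM n)) (Eventually.of_forall hG)
  rw [integral_zero] at hlim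
  refine not_lt.2 (ge_of_tendsto' hlim fun n => ?_) hu
  rw [← hμφ (G n)]
  exact hφG _ (subset_convexHull ℝ _ ⟨n, rfl⟩)

lemma mem_closure_convexHull_of_iterated_limits {S : Type*} [TopologicalSpace S]
    (f : ℕ → S →ᵇ ℝ) (f₀ : S →ᵇ ℝ) {M : ℝ} (hM : ∀ n, ‖f n‖ ≤ M)
    (h : ∀ (y : ℕ → S) (k : ℕ → ℝ), (∀ n, Tendsto (fun m => f n (y m) - f₀ (y m)) atTop (𝓝 (k n))) →
      Tendsto k atTop (𝓝 0)) :
    f₀ ∈ closure (convexHull ℝ (range f)) := by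
  set C := M + ‖f₀‖
  let ev : S → ℕ → ℝ := fun y n => f n y - f₀ y
  have hev : ∀ y n, ‖ev y n‖ ≤ C := fun y n =>
    (norm_sub_le _ _).trans (add_le_add (((f n).norm_coe_le_norm y).trans (hM n))
      (f₀.norm_coe_le_norm y))
  have hsub : closure (range ev) ⊆ Set.pi univ fun _ => Metric.closedBall (0 : ℝ) C := by
    refine closure_minimal ?_ (isClosed_set_pi fun _ _ => Metric.isClosed_closedBall)
    rintro _ ⟨y, rfl⟩ n _
    simpa using hev y n
  have hK : IsCompact (closure (range ev)) :=
    (isCompact_univ_pi fun _ => isCompact_closedBall (0 : ℝ) C).of_isClosed_subset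
      isClosed_closure hsub
  have : CompactSpace (closure (range ev)) := isCompact_iff_compactSpace.1 hK
  let G : ℕ → C(closure (range ev), ℝ) := fun n => ⟨fun k => |k.1 n|,
    continuous_abs.comp ((continuous_apply n).comp continuous_subtype_val)⟩
  have hGM : ∀ n k, ‖G n k‖ ≤ C := fun n k => by
    have := hsub k.2 n (mem_univ n)
    simpa [G] using this
  have hG : ∀ k, Tendsto (fun n => G n k) atTop (𝓝 0) := by
    intro k
    obtain ⟨x, hx, hxk⟩ := mem_closure_iff_seq_limit.1 k.2
    choose y hy using hx
    have := h y k.1 fun n => by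
      have h1 := (tendsto_pi_nhds.1 hxk) n
      refine h1.congr fun m => ?_
      rw [← hy m]
    simpa [G] using this.abs
  rw [Metric.mem_closure_iff]
  intro ε hε
  obtain ⟨g, hg, hgε⟩ := exists_convexHull_lt_of_tendsto G hGM hG (half_pos hε)
  rw [convexHull_eq] at hg
  obtain ⟨ι, t, w, z, hw, hw1, hz, rfl⟩ := hg
  choose! n hn using hz
  refine ⟨∑ i ∈ t, w i • f (n i), ?_, ?_⟩
  · exact (convex_convexHull ℝ _).sum_mem hw hw1 fun i _ => subset_convexHull ℝ _ ⟨n i, rfl⟩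
  · rw [dist_comm, dist_eq_norm]
    refine lt_of_le_of_lt ((BoundedContinuousFunction.norm_le (half_pos hε).le).2 fun y => ?_)
      (half_lt_self hε)
    have h1 := hgε ⟨ev y, subset_closure ⟨y, rfl⟩⟩
    rw [Finset.centerMass_eq_of_sum_1 _ _ hw1, ContinuousMap.sum_apply] at h1
    refine le_trans ?_ h1.le
    have e : (∑ i ∈ t, w i • f (n i) - f₀) y = ∑ i ∈ t, w i * ev y (n i) := by
      have : f₀ y = ∑ i ∈ t, w i * f₀ y := by rw [← Finset.sum_mul, hw1, one_mul]
      simp only [ev, mul_sub, Finset.sum_sub_distrib, ← this]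
      simp
    rw [e]
    refine (norm_sum_le _ _).trans (Finset.sum_le_sum fun i hi => ?_)
    rw [norm_mul, Real.norm_of_nonneg (hw i hi), ← hn i hi]
    rfl

end ConvexCombinations

section Types

variable {X : Type*} [NormedAddCommGroup X]

namespace Determines

variable {x : ℕ → X} {σ : X → ℝ}

lemma comp (h : Determines x σ) {φ : ℕ → ℕ} (hφ : Tendsto φ atTop atTop) :
    Determines (x ∘ φ) σ := fun y => (h y).comp hφ

lemma add_left (h : Determines x σ) (z : X) :
    Determines (fun n => z + x n) fun y => σ (y + z) := fun y =>
  (h (y + z)).congr fun n => by rw [add_assoc]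

lemma nonneg (h : Determines x σ) (y : X) : 0 ≤ σ y :=
  ge_of_tendsto' (h y) fun _ => norm_nonneg _

lemma le_add (h : Determines x σ) (y z : X) : σ y ≤ σ z + ‖y - z‖ := by
  refine le_of_tendsto_of_tendsto' (h y) ((h z).add_const ‖y - z‖) fun n => ?_
  calc ‖y + x n‖ = ‖(z + x n) + (y - z)‖ := by congr 1; abel
    _ ≤ _ := norm_add_le _ _

lemma norm_le (h : Determines x σ) (y : X) : ‖y‖ ≤ σ y + σ 0 := by
  refine ge_of_tendsto' ((h y).add (h 0)) fun n => ?_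
  calc ‖y‖ = ‖(y + x n) - (0 + x n)‖ := by congr 1; abel
    _ ≤ _ := norm_sub_le _ _

lemma continuous (h : Determines x σ) : Continuous σ := by
  refine LipschitzWith.continuous (K := 1) (LipschitzWith.of_le_add fun y z => ?_)
  rw [dist_eq_norm]
  exact h.le_add y z

end Determines

lemma exists_determines_subseq [TopologicalSpace.SeparableSpace X] {x : ℕ → X} {C : ℝ}
    (hx : ∀ n, ‖x n‖ ≤ C) : ∃ φ : ℕ → ℕ, StrictMono φ ∧ ∃ σ, Determines (x ∘ φ) σ := by
  let d := TopologicalSpace.denseSeq X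
  let v : ℕ → ℕ → ℝ := fun n i => ‖d i + x n‖
  have hK : IsCompact (Set.pi univ fun i => Icc (0 : ℝ) (‖d i‖ + C)) :=
    isCompact_univ_pi fun _ => isCompact_Icc
  obtain ⟨k, -, φ, hφ, hk⟩ := hK.tendsto_subseq (x := v) fun n i _ =>
    ⟨norm_nonneg _, (norm_add_le _ _).trans (by gcongr; exact hx n)⟩
  refine ⟨φ, hφ, ?_⟩
  have hc : ∀ y, ∃ l, Tendsto (fun n => ‖y + x (φ n)‖) atTop (𝓝 l) := by
    intro y
    refine cauchySeq_tendsto_of_complete (Metric.cauchySeq_iff'.2 fun ε hε => ?_)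
    obtain ⟨_, ⟨i, rfl⟩, hi⟩ := Metric.mem_closure_iff.1
      (TopologicalSpace.denseRange_denseSeq X y) (ε / 3) (by positivity)
    have hi' : ∀ n, |‖y + x (φ n)‖ - ‖d i + x (φ n)‖| < ε / 3 := fun n => by
      refine (abs_norm_sub_norm_le _ _).trans_lt ?_
      rw [add_sub_add_right_eq_sub, ← dist_eq_norm]
      exact hi
    obtain ⟨N, hN⟩ := Metric.cauchySeq_iff'.1 (tendsto_pi_nhds.1 hk i).cauchySeq (ε / 3)
      (by positivity)
    refine ⟨N, fun n hn => ?_⟩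
    have h₁ := hN n hn
    have h₂ := hi' n
    have h₃ := hi' N
    simp only [Real.dist_eq, Function.comp, v] at h₁ ⊢
    rw [abs_lt] at *
    constructor <;> linarith [h₁.1, h₁.2, h₂.1, h₂.2, h₃.1, h₃.2]
  choose σ hσ using hc
  exact ⟨σ, hσ⟩

end Types

section TypeIntegral

variable {X : Type*} [NormedAddCommGroup X] [NormedSpace ℝ X] [MeasurableSpace X] [BorelSpace X]

lemma norm_exp_neg_le {a : ℝ} (ha : 0 ≤ a) : ‖Real.exp (-a)‖ ≤ 1 := by
  rw [Real.norm_eq_abs, Real.abs_exp]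
  exact Real.exp_le_one_iff.2 (by simpa)

namespace TypeSpace

lemma nonneg (σ : TypeSpace X) (y : X) : 0 ≤ σ.1 y := σ.2.elim fun _ h => h.nonneg y

lemma continuous (σ : TypeSpace X) : Continuous σ.1 := σ.2.elim fun _ h => h.continuous

lemma norm_le (σ : TypeSpace X) (y : X) : ‖y‖ ≤ σ.1 y + σ.1 0 := σ.2.elim fun _ h => h.norm_le y

end TypeSpace

lemma norm_integral_le_of_norm_le (μ : SignedMeasure X) {f : X → ℝ} {C : ℝ}
    (hf : ∀ x, ‖f x‖ ≤ C) : ‖∫ᵛ x, f x ∂•μ‖ ≤ C * μ.variation.real univ := by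
  have := VectorMeasure.norm_integral_le_of_norm_le_const (μ := μ)
    (B := ContinuousLinearMap.lsmul ℝ ℝ) (f := f) (C := C) (Eventually.of_forall hf)
  simpa using this

lemma tendsto_integral_exp (μ : SignedMeasure X) {F : ℕ → X → ℝ} {f : X → ℝ}
    (hF : ∀ n, Continuous (F n)) (h0 : ∀ n x, 0 ≤ F n x)
    (h : ∀ x, Tendsto (fun n => Real.exp (-F n x)) atTop (𝓝 (f x))) :
    Tendsto (fun n => ∫ᵛ x, Real.exp (-F n x) ∂•μ) atTop (𝓝 (∫ᵛ x, f x ∂•μ)) :=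
  VectorMeasure.tendsto_integral_of_dominated_convergence (fun _ => 1)
    (fun n => (Real.continuous_exp.comp (hF n).neg).aestronglyMeasurable) (integrable_const 1)
    (fun n => Eventually.of_forall fun x => norm_exp_neg_le (h0 n x)) (Eventually.of_forall h)

/-- The function `y ↦ ∫ e^{-σ(x - y)} μ(dx)`. -/
def typeIntegral (σ : TypeSpace X) (μ : SignedMeasure X) : X →ᵇ ℝ :=
  BoundedContinuousFunction.ofNormedAddCommGroup (fun y => ∫ᵛ x, Real.exp (-σ.1 (x - y)) ∂•μ)
    (VectorMeasure.continuous_of_dominated (bound := fun _ => 1)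
      (fun _ => (Real.continuous_exp.comp (σ.continuous.comp
        (continuous_id.sub continuous_const)).neg).aestronglyMeasurable)
      (fun _ => Eventually.of_forall fun _ => norm_exp_neg_le (σ.nonneg _))
      (integrable_const 1)
      (Eventually.of_forall fun _ => Real.continuous_exp.comp (σ.continuous.comp
        (continuous_const.sub continuous_id)).neg))
    (1 * μ.variation.real univ)
    (fun _ => norm_integral_le_of_norm_le μ fun _ => norm_exp_neg_le (σ.nonneg _))

lemma typeIntegral_apply (σ : TypeSpace X) (μ : SignedMeasure X) (y : X) :
    typeIntegral σ μ y = ∫ᵛ x, Real.exp (-σ.1 (x - y)) ∂•μ := rfl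

lemma transCb_Phi_apply (z : X) (μ : SignedMeasure X) (y : X) :
    transCb z (Phi X μ) y = ∫ᵛ x, Real.exp (-‖(x + z) - y‖) ∂•μ := by
  have h : transCb z (Phi X μ) y = ∫ᵛ x, Real.exp (-‖x - (y - z)‖) ∂•μ := rfl
  rw [h]
  congr 1
  funext x
  congr 3
  abel

lemma norm_typeIntegral_sub_le (σ τ : TypeSpace X) (μ : SignedMeasure X) {C : ℝ}
    (h : ∀ y, |Real.exp (-σ.1 y) - Real.exp (-τ.1 y)| ≤ C) :
    ‖typeIntegral σ μ - typeIntegral τ μ‖ ≤ C * μ.variation.real univ := by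
  have hC : 0 ≤ C := (abs_nonneg _).trans (h 0)
  refine (BoundedContinuousFunction.norm_le (mul_nonneg hC measureReal_nonneg)).2 fun y => ?_
  have hi : ∀ σ : TypeSpace X, μ.Integrable fun x : X => Real.exp (-σ.1 (x - y)) := fun σ =>
    Integrable.of_bound (Real.continuous_exp.comp (σ.continuous.comp
        (continuous_id.sub continuous_const)).neg).aestronglyMeasurable 1
      (Eventually.of_forall fun x => norm_exp_neg_le (σ.nonneg _))
  have e : (typeIntegral σ μ - typeIntegral τ μ) y
      = ∫ᵛ x, (Real.exp (-σ.1 (x - y)) - Real.exp (-τ.1 (x - y))) ∂•μ :=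
    (VectorMeasure.integral_fun_sub (hi σ) (hi τ)).symm
  rw [e]
  exact norm_integral_le_of_norm_le μ fun x => h (x - y)

lemma tendsto_exp_neg_zero {ι : Type*} {l : Filter ι} {f : ι → ℝ} (hf : Tendsto f l atTop) :
    Tendsto (fun i => Real.exp (-f i)) l (𝓝 0) :=
  Real.tendsto_exp_atBot.comp (tendsto_neg_atTop_atBot.comp hf)

lemma tendsto_norm_sub_atTop {y : ℕ → X} (hy : Tendsto (fun m => ‖y m‖) atTop atTop) (z : X) :
    Tendsto (fun m => ‖z - y m‖) atTop atTop := by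
  refine tendsto_atTop_mono (fun m => ?_) (tendsto_atTop_add_const_right _ (-‖z‖) hy)
  have := norm_sub_norm_le (y m) z
  rw [norm_sub_rev] at this
  linarith

lemma iterated_limits_zero [TopologicalSpace.SeparableSpace X] (hX : Stable X) {x : ℕ → X}
    (σ : TypeSpace X) (hx : Determines x σ.1) (μ : SignedMeasure X) {y : ℕ → X} {k : ℕ → ℝ}
    (hk : ∀ n, Tendsto (fun m => transCb (x n) (Phi X μ) (y m) - typeIntegral σ μ (y m)) atTop
      (𝓝 (k n))) :
    Tendsto k atTop (𝓝 0) := by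
  simp only [transCb_Phi_apply, typeIntegral_apply] at hk
  by_cases hy : Tendsto (fun m => ‖y m‖) atTop atTop
  · have h₁ : ∀ n, Tendsto (fun m => ∫ᵛ a, Real.exp (-‖(a + x n) - y m‖) ∂•μ) atTop
        (𝓝 (∫ᵛ _, 0 ∂•μ)) := fun n =>
      tendsto_integral_exp μ (fun m => by fun_prop) (fun m a => norm_nonneg _) fun a =>
        tendsto_exp_neg_zero (tendsto_norm_sub_atTop hy _)
    have h₂ : Tendsto (fun m => ∫ᵛ a, Real.exp (-σ.1 (a - y m)) ∂•μ) atTop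
        (𝓝 (∫ᵛ _, 0 ∂•μ)) :=
      tendsto_integral_exp μ (fun m => σ.continuous.comp (by fun_prop)) (fun m a => σ.nonneg _)
        fun a => tendsto_exp_neg_zero (tendsto_atTop_mono
          (fun m => by have := σ.norm_le (a - y m); linarith)
          (tendsto_atTop_add_const_right _ (-σ.1 0) (tendsto_norm_sub_atTop hy a)))
    have hk0 : k = fun _ => 0 := by
      funext n
      have := (h₁ n).sub h₂
      rw [sub_self] at this
      exact tendsto_nhds_unique (hk n) this
    rw [hk0]
    exact tendsto_const_nhds
  · rw [Filter.tendsto_atTop] at hy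
    push Not at hy
    obtain ⟨C, hC⟩ := hy
    obtain ⟨φ, hφ, hφC⟩ := extraction_of_frequently_atTop (not_eventually.1 hC)
    obtain ⟨ψ, hψ, τ, hτ⟩ := exists_determines_subseq (x := fun m => -y (φ m)) (C := C)
      fun m => by rw [norm_neg]; exact (not_not.1 (hφC m)).le
    have hl : ∀ a : X, ∃ l : ℝ, Tendsto (fun n => τ (a + x n)) atTop (𝓝 l) ∧
        Tendsto (fun m => σ.1 (a - y (φ (ψ m)))) atTop (𝓝 l) := fun a => by
      obtain ⟨l, h₁, h₂⟩ := hX _ _ _ _ (hx.add_left a) hτ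
      refine ⟨l, h₁, h₂.congr fun m => ?_⟩
      simp only [Function.comp, neg_add_eq_sub]
    choose l hl₁ hl₂ using hl
    have h₁ : ∀ n, Tendsto (fun m => ∫ᵛ a, Real.exp (-‖(a + x n) - y (φ (ψ m))‖) ∂•μ) atTop
        (𝓝 (∫ᵛ a, Real.exp (-τ (a + x n)) ∂•μ)) := fun n =>
      tendsto_integral_exp μ (fun m => by fun_prop) (fun m a => norm_nonneg _) fun a => by
        refine (Real.continuous_exp.tendsto _).comp (Tendsto.neg ?_)
        refine (hτ (a + x n)).congr fun m => ?_
        simp only [Function.comp, sub_eq_add_neg]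
    have h₂ : Tendsto (fun m => ∫ᵛ a, Real.exp (-σ.1 (a - y (φ (ψ m)))) ∂•μ) atTop
        (𝓝 (∫ᵛ a, Real.exp (-l a) ∂•μ)) :=
      tendsto_integral_exp μ (fun m => σ.continuous.comp (by fun_prop)) (fun m a => σ.nonneg _)
        fun a => (Real.continuous_exp.tendsto _).comp (hl₂ a).neg
    have hk0 : k = fun n => ∫ᵛ a, Real.exp (-τ (a + x n)) ∂•μ - ∫ᵛ a, Real.exp (-l a) ∂•μ := by
      funext n
      exact tendsto_nhds_unique ((hk n).comp (hφ.comp hψ).tendsto_atTop) ((h₁ n).sub h₂)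
    have h₃ : Tendsto (fun n => ∫ᵛ a, Real.exp (-τ (a + x n)) ∂•μ) atTop
        (𝓝 (∫ᵛ a, Real.exp (-l a) ∂•μ)) :=
      tendsto_integral_exp μ (fun n => hτ.continuous.comp (by fun_prop)) (fun n a => hτ.nonneg _)
        fun a => (Real.continuous_exp.tendsto _).comp (hl₁ a).neg
    rw [hk0]
    simpa using h₃.sub_const (∫ᵛ a, Real.exp (-l a) ∂•μ)

end TypeIntegral

section Representation

variable {X : Type*} [NormedAddCommGroup X] [NormedSpace ℝ X] [MeasurableSpace X] [BorelSpace X]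
  {θ : Ioo (0 : ℝ) 1} {p : Ioo (1 : ℝ≥0∞) ⊤}

open InterpSpace

lemma norm_transCb_le (z : X) : ‖transCb z‖ ≤ 1 :=
  LinearMap.mkContinuous_norm_le _ zero_le_one _

lemma norm_transA0_le (z : X) : ‖transA0 z‖ ≤ 1 :=
  LinearMap.mkContinuous_norm_le _ zero_le_one _

lemma norm_trans_apply_le (z : X) (r : R X θ p) : ‖trans θ p z r‖ ≤ ‖r‖ := by
  refine (norm_mapLM_le (transA0 z) (transCb z) (fun _ => rfl) r).trans ?_
  refine mul_le_of_le_one_left (norm_nonneg _) (mul_le_one₀ ?_ (by positivity) ?_)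
  · exact Real.rpow_le_one (norm_nonneg _) (norm_transA0_le z) (sub_pos.2 θ.2.2).le
  · exact Real.rpow_le_one (norm_nonneg _) (norm_transCb_le z) θ.2.1.le

lemma trans_embed (z : X) (a : A0 X) :
    trans θ p z (embed (A0.incl X) θ p a) = embed (A0.incl X) θ p (transA0 z a) := rfl

variable [TopologicalSpace.SeparableSpace X]

lemma exists_weak_limit (hX : Stable X) (σ : TypeSpace X) {x : ℕ → X} (hx : Determines x σ.1)
    {a : A0 X} {μ : SignedMeasure X} (hμ : Phi X μ = a.1) :
    ∃ w ∈ ballClosure (A0.incl X) θ p ‖a‖, w.1 = typeIntegral σ μ ∧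
      ∀ r' : StrongDual ℝ (R X θ p),
        Tendsto (fun n => r' (trans θ p (x n) (embed (A0.incl X) θ p a))) atTop (𝓝 (r' w)) := by
  simp only [trans_embed]
  refine tendsto_dual_of_convexHull (fun n => ?_) fun φ hφ => ?_
  · exact ((transA0 (x n)).le_opNorm a).trans
      (mul_le_of_le_one_left (norm_nonneg _) (norm_transA0_le _))
  · have e : (fun n => A0.incl X (transA0 (x (φ n)) a))
        = fun n => transCb (x (φ n)) (Phi X μ) := by
      funext n; rw [hμ]; rfl
    rw [e]
    refine mem_closure_convexHull_of_iterated_limits _ _ (M := ‖Phi X μ‖) (fun n => ?_)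
      fun y k hk => iterated_limits_zero hX σ (hx.comp hφ.tendsto_atTop) μ hk
    exact ((transCb (x (φ n))).le_opNorm _).trans
      (mul_le_of_le_one_left (norm_nonneg _) (norm_transCb_le _))

lemma exists_operator (hX : Stable X) (σ : TypeSpace X) {x : ℕ → X} (hx : Determines x σ.1) :
    ∃ T : R X θ p →L[ℝ] R X θ p, (∀ r, ‖T r‖ ≤ ‖r‖) ∧
      (∀ r (r' : StrongDual ℝ (R X θ p)),
        Tendsto (fun n => r' (trans θ p (x n) r)) atTop (𝓝 (r' (T r)))) ∧
      ∀ (a : A0 X) (μ : SignedMeasure X), Phi X μ = a.1 →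
        T (embed (A0.incl X) θ p a) ∈ ballClosure (A0.incl X) θ p ‖a‖ ∧
        (T (embed (A0.incl X) θ p a)).1 = typeIntegral σ μ := by
  obtain ⟨T, hT, hT'⟩ := exists_clm_of_tendsto_dual (fun n => trans θ p (x n))
    (fun n r => norm_trans_apply_le (x n) r) (denseRange_embed (j := A0.incl X) (θ := θ) (p := p))
    (by
      rintro _ ⟨a, rfl⟩
      obtain ⟨μ, hμ⟩ := a.2
      obtain ⟨w, -, -, hw⟩ := exists_weak_limit (θ := θ) (p := p) hX σ hx hμ
      exact ⟨w, hw⟩)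
  refine ⟨T, hT, hT', fun a μ hμ => ?_⟩
  obtain ⟨w, hw, hwμ, hw'⟩ := exists_weak_limit (θ := θ) (p := p) hX σ hx hμ
  have : T (embed (A0.incl X) θ p a) = w :=
    eq_of_forall_dual_eq fun r' => tendsto_nhds_unique (hT' _ r') (hw' r')
  rw [this]
  exact ⟨hw, hwμ⟩

lemma existsUnique_representation (hX : Stable X) (θ : Ioo (0 : ℝ) 1) (p : Ioo (1 : ℝ≥0∞) ⊤) :
    ∃! T : TypeSpace X → (R X θ p →L[ℝ] R X θ p), IsRepresentation θ p T := by
  choose x hx using fun σ : TypeSpace X => σ.2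
  choose T _ hT hT' using fun σ => exists_operator (θ := θ) (p := p) hX σ (hx σ)
  refine ⟨T, fun σ y hy r r' => ?_, fun S hS => ?_⟩
  · obtain ⟨S, -, hS, hS'⟩ := exists_operator (θ := θ) (p := p) hX σ hy
    have hST : S = T σ := by
      refine ContinuousLinearMap.coeFn_injective (DenseRange.equalizer
        (denseRange_embed (j := A0.incl X) (θ := θ) (p := p)) S.continuous (T σ).continuous ?_)
      funext a
      obtain ⟨μ, hμ⟩ := a.2
      exact Subtype.ext ((hS' a μ hμ).2.trans (hT' σ a μ hμ).2.symm)
    rw [← hST]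
    exact hS r r'
  · funext σ
    ext1 r
    exact eq_of_forall_dual_eq fun r' =>
      tendsto_nhds_unique (hS σ _ (hx σ) r r') (hT σ r r')

namespace IsRepresentation

variable {T : TypeSpace X → (R X θ p →L[ℝ] R X θ p)}

lemma eq_operator (hT : IsRepresentation θ p T) {σ : TypeSpace X} {x : ℕ → X}
    (hx : Determines x σ.1) {S : R X θ p →L[ℝ] R X θ p}
    (hS : ∀ r (r' : StrongDual ℝ (R X θ p)),
      Tendsto (fun n => r' (trans θ p (x n) r)) atTop (𝓝 (r' (S r)))) : T σ = S := by
  ext1 r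
  exact eq_of_forall_dual_eq fun r' => tendsto_nhds_unique (hT σ x hx r r') (hS r r')

lemma norm_apply_le (hX : Stable X) (hT : IsRepresentation θ p T) (σ : TypeSpace X)
    (r : R X θ p) : ‖T σ r‖ ≤ ‖r‖ := by
  obtain ⟨x, hx⟩ := σ.2
  obtain ⟨S, hS, hS', -⟩ := exists_operator (θ := θ) (p := p) hX σ hx
  rw [hT.eq_operator hx hS']
  exact hS r

lemma apply_embed (hX : Stable X) (hT : IsRepresentation θ p T) (σ : TypeSpace X) {a : A0 X}
    {μ : SignedMeasure X} (hμ : Phi X μ = a.1) :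
    T σ (embed (A0.incl X) θ p a) ∈ ballClosure (A0.incl X) θ p ‖a‖ ∧
      (T σ (embed (A0.incl X) θ p a)).1 = typeIntegral σ μ := by
  obtain ⟨x, hx⟩ := σ.2
  obtain ⟨S, -, hS, hS'⟩ := exists_operator (θ := θ) (p := p) hX σ hx
  rw [hT.eq_operator hx hS]
  exact hS' a μ hμ

end IsRepresentation

lemma tendsto_of_tendsto_on_dense {E : Type*} [NormedAddCommGroup E] [NormedSpace ℝ E]
    {U : ℕ → E →L[ℝ] E} {V : E →L[ℝ] E} (hU : ∀ n v, ‖U n v‖ ≤ ‖v‖) (hV : ∀ v, ‖V v‖ ≤ ‖v‖)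
    {S : Set E} (hS : Dense S) (h : ∀ v ∈ S, Tendsto (fun n => U n v) atTop (𝓝 (V v))) (v : E) :
    Tendsto (fun n => U n v) atTop (𝓝 (V v)) := by
  rw [Metric.tendsto_atTop]
  intro ε hε
  obtain ⟨s, hs, hsv⟩ := Metric.mem_closure_iff.1 (hS v) (ε / 3) (by positivity)
  obtain ⟨N, hN⟩ := Metric.tendsto_atTop.1 (h s hs) (ε / 3) (by positivity)
  refine ⟨N, fun n hn => ?_⟩
  have h₁ : dist (U n v) (U n s) ≤ dist v s := by
    rw [dist_eq_norm, dist_eq_norm, ← map_sub]; exact hU n _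
  have h₂ : dist (V s) (V v) ≤ dist v s := by
    rw [dist_comm, dist_eq_norm, dist_eq_norm, ← map_sub]; exact hV _
  have h₃ := hN n hn
  have := dist_triangle4 (U n v) (U n s) (V s) (V v)
  linarith

lemma tendstoUniformly_exp_neg {σ : ℕ → TypeSpace X} {τ : TypeSpace X} (h : TendstoS σ τ) :
    ∀ ε > 0, ∀ᶠ n in atTop, ∀ y, |Real.exp (-(σ n).1 y) - Real.exp (-τ.1 y)| ≤ ε := by
  intro ε hε
  have h0 : Tendsto (fun n => (σ n).1 0) atTop (𝓝 (τ.1 0)) :=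
    (h {0} Bornology.isBounded_singleton).tendsto_at (mem_singleton 0)
  obtain ⟨b, hb⟩ := (Real.tendsto_exp_atBot.eventually_lt_const hε).exists
  set C := -b + τ.1 0 + 1
  have hB := Metric.tendstoUniformlyOn_iff.1 (h (Metric.closedBall 0 C)
    Metric.isBounded_closedBall) ε hε
  filter_upwards [hB, h0.eventually_lt_const (lt_add_one (τ.1 0))] with n hn hn0 y
  by_cases hy : ‖y‖ ≤ C
  · have h₁ := hn y (by simpa using hy)
    rw [Real.dist_eq, abs_sub_comm] at h₁
    refine le_trans ?_ h₁.le
    have hexp : ∀ a b : ℝ, 0 ≤ a → 0 ≤ b → Real.exp (-a) - Real.exp (-b) ≤ |a - b| := by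
      intro a b ha hb
      have h₂ := Real.add_one_le_exp (a - b)
      have h₃ : Real.exp (-b) = Real.exp (-a) * Real.exp (a - b) := by
        rw [← Real.exp_add]; congr 1; ring
      have h₄ : Real.exp (-a) ≤ 1 := Real.exp_le_one_iff.2 (by linarith)
      have h₅ := Real.exp_pos (-a)
      have h₆ := neg_abs_le (a - b)
      have h₇ := abs_nonneg (a - b)
      rw [h₃]
      nlinarith
    refine abs_le.2 ⟨?_, hexp _ _ ((σ n).nonneg y) (τ.nonneg y)⟩
    have := hexp _ _ (τ.nonneg y) ((σ n).nonneg y)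
    rw [abs_sub_comm] at this
    linarith
  · have h₁ := (σ n).norm_le y
    have h₂ := τ.norm_le y
    have h₃ : Real.exp (-(σ n).1 y) ≤ Real.exp b := Real.exp_le_exp.2 (by linarith)
    have h₄ : Real.exp (-τ.1 y) ≤ Real.exp b := Real.exp_le_exp.2 (by linarith)
    have h₅ := Real.exp_pos (-(σ n).1 y)
    have h₆ := Real.exp_pos (-τ.1 y)
    rw [abs_le]
    constructor <;> linarith

lemma tendsto_operator_of_tendstoS (hX : Stable X) {T : TypeSpace X → (R X θ p →L[ℝ] R X θ p)}
    (hT : IsRepresentation θ p T) {σ : ℕ → TypeSpace X} {τ : TypeSpace X} (h : TendstoS σ τ)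
    (r : R X θ p) : Tendsto (fun n => T (σ n) r) atTop (𝓝 (T τ r)) := by
  refine tendsto_of_tendsto_on_dense (fun n => hT.norm_apply_le hX (σ n)) (hT.norm_apply_le hX τ)
    (denseRange_embed (j := A0.incl X) (θ := θ) (p := p)) ?_ r
  rintro _ ⟨a, rfl⟩
  obtain ⟨μ, hμ⟩ := a.2
  have hsup : Tendsto (fun n => ‖typeIntegral (σ n) μ - typeIntegral τ μ‖) atTop (𝓝 0) := by
    rw [Metric.tendsto_atTop]
    intro ε hε
    set V := μ.variation.real univ
    have hV : 0 ≤ V := measureReal_nonneg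
    obtain ⟨N, hN⟩ := eventually_atTop.1 (tendstoUniformly_exp_neg h (ε / (V + 1)) (by positivity))
    refine ⟨N, fun n hn => ?_⟩
    rw [Real.dist_0_eq_abs, abs_norm]
    refine (norm_typeIntegral_sub_le _ _ μ (hN n hn)).trans_lt ?_
    rw [div_mul_eq_mul_div, div_lt_iff₀ (by positivity)]
    nlinarith
  rw [tendsto_iff_norm_sub_tendsto_zero]
  have h₂ := ((continuous_modulus θ p ‖a‖).tendsto 0).comp hsup
  rw [modulus_zero] at h₂
  refine squeeze_zero (fun _ => norm_nonneg _) (fun n => ?_) h₂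
  obtain ⟨m₁, e₁⟩ := hT.apply_embed hX (σ n) hμ
  obtain ⟨m₂, e₂⟩ := hT.apply_embed hX τ hμ
  have := dist_le_modulus m₁ m₂
  rwa [e₁, e₂] at this

lemma typeIntegral_dirac (σ : TypeSpace X) (y : X) :
    typeIntegral σ (VectorMeasure.dirac 0 1) y = Real.exp (-σ.1 (-y)) := by
  rw [typeIntegral_apply, VectorMeasure.integral_dirac']
  · simp
  · exact (Real.continuous_exp.comp (σ.continuous.comp
      (continuous_id.sub continuous_const)).neg).stronglyMeasurable

lemma tendstoS_of_tendsto_operator (hX : Stable X) {T : TypeSpace X → (R X θ p →L[ℝ] R X θ p)}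
    (hT : IsRepresentation θ p T) {σ : ℕ → TypeSpace X} {τ : TypeSpace X}
    (h : ∀ r : R X θ p, Tendsto (fun n => T (σ n) r) atTop (𝓝 (T τ r))) : TendstoS σ τ := by
  set μ : SignedMeasure X := VectorMeasure.dirac 0 1
  let a : A0 X := ⟨Phi X μ, μ, rfl⟩
  have hμ : Phi X μ = a.1 := rfl
  have hsup := ((val (A0.incl X) θ p).continuous.tendsto _).comp (h (embed (A0.incl X) θ p a))
  simp only [Function.comp_def, val_apply, (hT.apply_embed hX _ hμ).2] at hsup
  have hexp : ∀ ε > 0, ∀ᶠ n in atTop, ∀ y, |Real.exp (-(σ n).1 y) - Real.exp (-τ.1 y)| < ε := by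
    intro ε hε
    filter_upwards [Metric.tendsto_nhds.1 hsup ε hε] with n hn y
    have h₁ := (BoundedContinuousFunction.dist_coe_le_dist (-y)).trans_lt hn
    rwa [typeIntegral_dirac, typeIntegral_dirac, neg_neg, Real.dist_eq] at h₁
  intro B hB
  obtain ⟨C, hC⟩ := hB.exists_norm_le
  have hτ : ∀ y ∈ B, τ.1 y ≤ C + τ.1 0 := fun y hy => by
    obtain ⟨x, hx⟩ := τ.2
    have h₁ := hx.le_add y 0
    have h₂ := hC y hy
    rw [sub_zero] at h₁
    linarith
  set δ := Real.exp (-(C + τ.1 0))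
  have hδ : 0 < δ := Real.exp_pos _
  rw [Metric.tendstoUniformlyOn_iff]
  intro ε hε
  filter_upwards [hexp (min (δ / 2) (δ / 2 * ε)) (by positivity)] with n hn y hy
  have h₁ := hn y
  have h₂ : δ ≤ Real.exp (-τ.1 y) := Real.exp_le_exp.2 (neg_le_neg (hτ y hy))
  have h₃ := h₁.trans_le (min_le_left _ _)
  have h₄ := h₁.trans_le (min_le_right _ _)
  have h₅ : δ / 2 < Real.exp (-(σ n).1 y) := by
    have := (abs_lt.1 h₃).1; linarith
  have key : ∀ s t : ℝ, δ / 2 ≤ Real.exp (-s) → Real.exp (-t) - Real.exp (-s) < δ / 2 * ε →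
      s - t < ε := by
    intro s t hs hst
    have h₆ := Real.add_one_le_exp (s - t)
    have h₇ : Real.exp (-t) = Real.exp (-s) * Real.exp (s - t) := by
      rw [← Real.exp_add]; congr 1; ring
    by_contra! hcon
    rw [h₇] at hst
    nlinarith [Real.exp_pos (-s)]
  rw [Real.dist_eq, abs_lt]
  constructor
  · have := key ((σ n).1 y) (τ.1 y) h₅.le (by rw [abs_lt] at h₄; linarith [h₄.1])
    linarith
  · exact key _ _ (by linarith) (lt_of_abs_lt h₄)

end Representation

end StableRep

end

theorem theorem7 (X : Type*) [NormedAddCommGroup X] [NormedSpace ℝ X] [CompleteSpace X]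
    [TopologicalSpace.SeparableSpace X] [MeasurableSpace X] [BorelSpace X]
    (hX : StableRep.Stable X) (θ : Set.Ioo (0 : ℝ) 1) (p : Set.Ioo (1 : ℝ≥0∞) ⊤) :
    (∃! T : StableRep.TypeSpace X → (StableRep.R X θ p →L[ℝ] StableRep.R X θ p),
      StableRep.IsRepresentation θ p T) ∧
    ∀ T : StableRep.TypeSpace X → (StableRep.R X θ p →L[ℝ] StableRep.R X θ p),
      StableRep.IsRepresentation θ p T →
      ∀ (σ : ℕ → StableRep.TypeSpace X) (τ : StableRep.TypeSpace X),
        StableRep.TendstoS σ τ ↔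
          ∀ r : StableRep.R X θ p, Tendsto (fun n => T (σ n) r) atTop (𝓝 (T τ r)) := by
  refine ⟨StableRep.existsUnique_representation hX θ p, fun T hT σ τ => ⟨fun h r => ?_, fun h => ?_⟩⟩
  · exact StableRep.tendsto_operator_of_tendstoS hX hT h r
  · exact StableRep.tendstoS_of_tendsto_operator hX hT h
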